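/- Let $N$ be a real vector space of dimension $n$, let $m=n+2\ell$, and let $\mathbf a_1,\dots,\mathbf a_m\in N$, $b_1,\dots,b_m\in\mathbb R$ be such that $$P=\{u\in N^*:\ \langle \mathbf a_i,u\rangle+b_i\ge 0,\ i=1,\dots,m\}$$ is a simple convex polytope of dimension $n$; here each set $F_i=P\cap\{\langle \mathbf a_i,u\rangle+b_i=0\}$ is either empty or a facet of $P$, and the nonempty $F_i$ are pairwise distinct. Let $\mathcal K=\{I\subset\{1,\dots,m\}: P\cap\bigcap_{i\in I}F_i\ne\varnothing\}$, so that $\{\mathcal K;\mathbf a_1,\dots,\mathbf a_m\}$ define the normal fan $\Sigma=\Sigma_P$, whose cones are spanned by $\{\mathbf a_i: i\in I\}$, $I\in\mathcal K$. Put $$U(\mathcal K)=\mathbb C^m\setminus\bigcup_{I\notin\mathcal K}\{\mathbf z: z_i=0\ \text{for all } i\in I\}.$$ Let $A:\mathbb R^m\to N$, $\mathbf e_i\mapsto\mathbf a_i$, with complexification $A_{\mathbb C}:\mathbb C^m\to N\otimes\mathbb C$. Let $\Psi:\mathbb C^\ell\to\mathbb C^m$ be a $\mathbb C$-linear map such that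 $\operatorname{Re}\circ\Psi:\mathbb C^\ell\to\mathbb R^m$ is injective and $A\circ\operatorname{Re}\circ\Psi=0$. The groups $C=\exp\Psi(\mathbb C^\ell)\subset G=\exp(\operatorname{Ker}A_{\mathbb C})\subset(\mathbb C^\times)^m$ act on $U(\mathcal K)$ by coordinatewise multiplication. Let $\mathcal Z_{\mathcal K}=U(\mathcal K)/C$ with the quotient topology, and let $$\mathcal Z_P=\{\mathbf z\in\mathbb C^m:\ (|z_1|^2,\dots,|z_m|^2)=(\langle \mathbf a_1,u\rangle+b_1,\dots,\langle \mathbf a_m,u\rangle+b_m)\ \text{for some }u\in P\}.$$ Then $\mathcal Z_{\mathcal K}$ has the structure of a complex manifold of dimension $n+\ell$ for which the projection $U(\mathcal K)\to\mathcal Z_{\mathcal K}$ is a holomorphic submersion (such a structure is unique), and the orbits of $D=G/C$ define a smooth holomorphic foliation $\mathcal F$ of $\mathcal Z_{\mathcal K}$ of complex dimension $\ell$, whose tangent space at $x$ is the image of the differential at the unit of the orbit map $D\to\mathcal Z_{\mathcal K}$, $g\mapsto g\cdot x$. Moreover $\mathcal Z_P\subset U(\mathcal K)$, the composition $\mathcal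 Z_P\hookrightarrow U(\mathcal K)\to\mathcal Z_{\mathcal K}$ is a homeomorphism, and its inverse $\varphi:\mathcal Z_{\mathcal K}\to\mathcal Z_P\subset\mathbb C^m$ is a smooth embedding into $\mathbb C^m$ with image $\mathcal Z_P$. Finally, the form $$\omega_{\mathcal F}=\varphi^*\omega,\qquad \omega=\tfrac i2\sum_{k=1}^m dz_k\wedge d\bar z_k ,$$ (the pullback under $\varphi$ of the restriction of the standard Kähler form of $\mathbb C^m$ to $\mathcal Z_P$) is transverse Kähler with respect to $\mathcal F$: it is a smooth closed real $(1,1)$-form on $\mathcal Z_{\mathcal K}$ such that $\omega_{\mathcal F}(V,JV)\ge 0$ for every real tangent vector $V$, with equality if and only if $V$ is tangent to $\mathcal F$, where $J$ is the operator of the complex structure. -/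

import Mathlib

open Set Topology
open scoped Manifold ContDiff

noncomputable section

namespace MomentAngle

/-! ### Differential forms and foliations on complex manifolds

Throughout, a complex manifold of dimension `d` is modelled on `Fin d → ℂ`, with holomorphic
transition maps.  Its real tangent space `TangentSpace 𝓘(ℝ, Fin d → ℂ) x` and its complex tangent
space `TangentSpace 𝓘(ℂ, Fin d → ℂ) x` are the same set `Fin d → ℂ`, read in the preferred chart
at `x`. -/

section Manifold

/-- Real-valued 2-forms (no regularity) on a manifold modelled on `Fin d → ℂ`. -/
abbrev TwoForm (d : ℕ) (M : Type*) [TopologicalSpace M] [ChartedSpace (Fin d → ℂ) M] : Type _ :=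
  (x : M) → (TangentSpace 𝓘(ℝ, Fin d → ℂ) x) [⋀^Fin 2]→L[ℝ] ℝ

variable {d : ℕ} {M : Type*} [TopologicalSpace M] [ChartedSpace (Fin d → ℂ) M]

/-- The operator of complex structure `J` on the real tangent space: multiplication by `i`
(in the preferred chart, hence in every holomorphic chart of a complex manifold). -/
def complexJ (x : M) (v : TangentSpace 𝓘(ℝ, Fin d → ℂ) x) : TangentSpace 𝓘(ℝ, Fin d → ℂ) x :=
  (Complex.I • (show Fin d → ℂ from v) : Fin d → ℂ)

/-- The expression of a 2-form in a chart `e`: the pullback by `e.symm`, a form on `e.target`. -/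
def TwoForm.inChart (α : TwoForm d M) (e : OpenPartialHomeomorph M (Fin d → ℂ)) :
    (Fin d → ℂ) → (Fin d → ℂ) [⋀^Fin 2]→L[ℝ] ℝ :=
  fun y => (α (e.symm y)).compContinuousLinearMap
    (mfderiv 𝓘(ℝ, Fin d → ℂ) 𝓘(ℝ, Fin d → ℂ) e.symm y)

/-- The 2-form is `C^∞` (in all charts of the atlas). -/
def TwoForm.IsSmooth (α : TwoForm d M) : Prop :=
  ∀ e ∈ atlas (Fin d → ℂ) M, ContDiffOn ℝ ∞ (α.inChart e) e.target

/-- The 2-form is closed: its exterior derivative vanishes (in all charts of the atlas). -/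
def TwoForm.IsClosed (α : TwoForm d M) : Prop :=
  ∀ e ∈ atlas (Fin d → ℂ) M, ∀ y ∈ e.target, extDeriv (α.inChart e) y = 0

/-- A real 2-form is of type (1,1) iff it is invariant under `J`. -/
def TwoForm.IsOneOne (α : TwoForm d M) : Prop :=
  ∀ (x : M) (v w : TangentSpace 𝓘(ℝ, Fin d → ℂ) x),
    α x ![complexJ x v, complexJ x w] = α x ![v, w]

/-- Pullback of a constant-coefficient 2-form on `ℂ^m` along a map `f : M → ℂ^m`. -/
def pullbackForm {m : ℕ} (f : M → (Fin m → ℂ)) (α : (Fin m → ℂ) [⋀^Fin 2]→L[ℝ] ℝ) :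
    TwoForm d M :=
  fun x => ContinuousAlternatingMap.compContinuousLinearMap α
    (mfderiv 𝓘(ℝ, Fin d → ℂ) 𝓘(ℝ, Fin m → ℂ) f x)

/-- A field of complex subspaces of the tangent spaces. -/
abbrev Distribution (d : ℕ) (M : Type*) [TopologicalSpace M] [ChartedSpace (Fin d → ℂ) M] :
    Type _ :=
  (x : M) → Submodule ℂ (TangentSpace 𝓘(ℂ, Fin d → ℂ) x)

/-- `T` is the tangent distribution of a smooth holomorphic foliation of complex dimension `k`:
near each point there is a holomorphic chart in which `T` is a constant `k`-dimensional subspace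
(so that the leaves are locally the translates of that subspace). -/
def IsHolomorphicFoliation (k : ℕ) (T : Distribution d M) : Prop :=
  ∀ x : M, ∃ e ∈ IsManifold.maximalAtlas 𝓘(ℂ, Fin d → ℂ) ω M, x ∈ e.source ∧
    ∃ L : Submodule ℂ (Fin d → ℂ), Module.finrank ℂ L = k ∧
      ∀ y ∈ e.source,
        (T y).map (mfderiv 𝓘(ℂ, Fin d → ℂ) 𝓘(ℂ, Fin d → ℂ) e y).toLinearMap = L

/-- `α` is transverse Kähler with respect to the foliation with tangent distribution `T`: it is a
smooth closed real (1,1)-form, `α(V, JV) ≥ 0` for every real tangent vector `V`, and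
`α(V, JV) = 0` iff `V` is tangent to the foliation. -/
structure IsTransverseKahler (T : Distribution d M) (α : TwoForm d M) : Prop where
  smooth : α.IsSmooth
  oneOne : α.IsOneOne
  closed : α.IsClosed
  nonneg : ∀ (x : M) (v : TangentSpace 𝓘(ℝ, Fin d → ℂ) x), 0 ≤ α x ![v, complexJ x v]
  eq_zero_iff : ∀ (x : M) (v : TangentSpace 𝓘(ℝ, Fin d → ℂ) x),
    α x ![v, complexJ x v] = 0 ↔ (show TangentSpace 𝓘(ℂ, Fin d → ℂ) x from v) ∈ T x

end Manifold

/-- The standard Kähler form `(i/2) ∑ dz_k ∧ d\bar z_k = ∑ dx_k ∧ dy_k` of `ℂ^m`, i.e.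
`(v, w) ↦ ∑ (Re v_k Im w_k - Im v_k Re w_k)`. -/
def standardForm (m : ℕ) : (Fin m → ℂ) [⋀^Fin 2]→L[ℝ] ℝ where
  toFun v := ∑ k, ((v 0 k).re * (v 1 k).im - (v 0 k).im * (v 1 k).re)
  map_update_add' {inst} v i x y := by
    rw [Subsingleton.elim inst (instDecidableEqFin 2)]
    rw [← Finset.sum_add_distrib]
    refine Finset.sum_congr rfl fun k _ => ?_
    fin_cases i <;> simp <;> ring
  map_update_smul' {inst} v i c x := by
    rw [Subsingleton.elim inst (instDecidableEqFin 2)]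
    rw [smul_eq_mul, Finset.mul_sum]
    refine Finset.sum_congr rfl fun k _ => ?_
    fin_cases i <;> simp <;> ring
  map_eq_zero_of_eq' v i j hv hij := by
    have h : v 0 = v 1 := by
      fin_cases i <;> fin_cases j <;> simp_all
    refine Finset.sum_eq_zero fun k _ => ?_
    rw [h]; ring
  cont := by fun_prop

/-! ### Polytopes, nerve complexes and quadrics -/

section Polytope

variable {N : Type*} [NormedAddCommGroup N] [NormedSpace ℝ N] {m : ℕ}

/-- The polyhedron `P = {u ∈ N* : ⟨a_i, u⟩ + b_i ≥ 0 for all i}`. -/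
def polyhedron (a : Fin m → N) (b : Fin m → ℝ) : Set (StrongDual ℝ N) :=
  {u | ∀ i, 0 ≤ u (a i) + b i}

/-- The intersection `F_i` of `P` with the `i`-th hyperplane. -/
def facet (a : Fin m → N) (b : Fin m → ℝ) (i : Fin m) : Set (StrongDual ℝ N) :=
  {u ∈ polyhedron a b | u (a i) + b i = 0}

/-- The inequalities `⟨a_i, u⟩ + b_i ≥ 0` present a simple polytope of full dimension
`n = dim N`.  Redundant inequalities are allowed provided that their hyperplane misses `P`; the
other inequalities define facets, and each facet is listed once (this is included in `simple`, in
which the indices `i` with `u ∈ F_i` are counted). -/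
structure IsSimplePolytope (a : Fin m → N) (b : Fin m → ℝ) : Prop where
  bounded : Bornology.IsBounded (polyhedron a b)
  fullDim : (interior (polyhedron a b)).Nonempty
  facets : ∀ i, facet a b i = ∅ ∨
    Module.finrank ℝ (vectorSpan ℝ (facet a b i)) + 1 = Module.finrank ℝ N
  simple : ∀ u ∈ (polyhedron a b).extremePoints ℝ,
    {i | u ∈ facet a b i}.ncard = Module.finrank ℝ N

/-- The nerve complex `K_P = {I ⊆ [m] : ⋂_{i ∈ I} F_i ≠ ∅}`, the intersection being taken inside
`P` (so that `∅ ∈ K_P`).  For a simple polytope `P`, the normal fan `Σ_P` is the simplicial fan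
whose cones are spanned by `{a_i : i ∈ I}`, `I ∈ K_P`. -/
def nerveComplex (a : Fin m → N) (b : Fin m → ℝ) : Set (Finset (Fin m)) :=
  {I | ∃ u ∈ polyhedron a b, ∀ i ∈ I, u ∈ facet a b i}

/-- The quadric model `Z_P`, the fibre product of `z ↦ (|z_1|^2, …, |z_m|^2)` and
`i_P : P → ℝ^m`, `u ↦ (⟨a_k, u⟩ + b_k)_k`, viewed as a subset of `ℂ^m`. -/
def quadricModel (a : Fin m → N) (b : Fin m → ℝ) : Set (Fin m → ℂ) :=
  {z | ∃ u ∈ polyhedron a b, ∀ k, ‖z k‖ ^ 2 = u (a k) + b k}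

/-- The kernel of `A_ℂ : ℂ^m → N_ℂ = N ⊕ iN`, `e_i ↦ a_i`. -/
def kerAC (a : Fin m → N) : Submodule ℂ (Fin m → ℂ) where
  carrier := {w | ∑ i, (w i).re • a i = 0 ∧ ∑ i, (w i).im • a i = 0}
  zero_mem' := by simp
  add_mem' := by
    rintro v w ⟨hv, hv'⟩ ⟨hw, hw'⟩
    simp [add_smul, Finset.sum_add_distrib, hv, hv', hw, hw']
  smul_mem' := by
    rintro c w ⟨hw, hw'⟩
    simp only [mem_ofPred_eq, Pi.smul_apply, smul_eq_mul, Complex.mul_re, Complex.mul_im, sub_smul,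
      add_smul, mul_smul, Finset.sum_sub_distrib, Finset.sum_add_distrib, ← Finset.smul_sum,
      hw, hw', smul_zero, sub_zero, add_zero, and_self]

/-- The conditions on the choice of `Ψ : ℂ^ℓ → ℂ^m`: `Re ∘ Ψ` is injective and `A ∘ Re ∘ Ψ = 0`. -/
structure IsAdmissible {ℓ : ℕ} (a : Fin m → N) (Ψ : (Fin ℓ → ℂ) →ₗ[ℂ] (Fin m → ℂ)) : Prop where
  injective : Function.Injective fun (ζ : Fin ℓ → ℂ) (i : Fin m) => (Ψ ζ i).re
  comp_eq_zero : ∀ ζ, ∑ i, (Ψ ζ i).re • a i = 0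

end Polytope

/-! ### The quotient `Z_K = U(K)/C` -/

section Quotient

variable {m ℓ : ℕ}

/-- `U(K)`, the complement in `ℂ^m` of the coordinate subspaces `{z : z_i = 0 for i ∈ I}`,
`I ∉ K`, as an open subset of `ℂ^m`. -/
def U (K : Set (Finset (Fin m))) : TopologicalSpace.Opens (Fin m → ℂ) where
  carrier := {z | ∀ I ∉ K, ¬ ∀ i ∈ I, z i = 0}
  is_open' := by
    have h : {z : Fin m → ℂ | ∀ I ∉ K, ¬ ∀ i ∈ I, z i = 0} =
        ⋂ I : Finset (Fin m), ⋂ _ : I ∉ K, (⋂ i ∈ I, {z : Fin m → ℂ | z i = 0})ᶜ := by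
      ext z; simp
    rw [h]
    refine isOpen_iInter_of_finite fun I => isOpen_iInter_of_finite fun _ => ?_
    rw [isOpen_compl_iff]
    exact isClosed_biInter fun i _ => isClosed_eq (continuous_apply i) continuous_const

/-- The action of `exp v ∈ (ℂ^×)^m`, `v ∈ ℂ^m`, on `U(K)` by coordinatewise multiplication. -/
def expAct {K : Set (Finset (Fin m))} (v : Fin m → ℂ) (z : U K) : U K :=
  ⟨fun i => Complex.exp (v i) * z.1 i, fun I hI h =>
    z.2 I hI fun i hi => (mul_eq_zero.1 (h i hi)).resolve_left (Complex.exp_ne_zero _)⟩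

/-- The orbit equivalence relation of the group `C = exp(Ψ(ℂ^ℓ))` on `U(K)`. -/
def orbitSetoid (K : Set (Finset (Fin m))) (Ψ : (Fin ℓ → ℂ) →ₗ[ℂ] (Fin m → ℂ)) : Setoid (U K) where
  r z w := ∃ ζ, expAct (Ψ ζ) z = w
  iseqv :=
    { refl := fun z => ⟨0, by ext; simp [expAct]⟩
      symm := by
        rintro z w ⟨ζ, rfl⟩
        refine ⟨-ζ, ?_⟩
        ext i
        simp [expAct, ← mul_assoc, ← Complex.exp_add]
      trans := by
        rintro z w y ⟨ζ, rfl⟩ ⟨η, rfl⟩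
        refine ⟨η + ζ, ?_⟩
        ext i
        simp [expAct, ← mul_assoc, ← Complex.exp_add] }

/-- The moment-angle manifold `Z_K = U(K)/C`, with the quotient topology. -/
def ZK (K : Set (Finset (Fin m))) (Ψ : (Fin ℓ → ℂ) →ₗ[ℂ] (Fin m → ℂ)) : Type :=
  Quotient (orbitSetoid K Ψ)

instance (K : Set (Finset (Fin m))) (Ψ : (Fin ℓ → ℂ) →ₗ[ℂ] (Fin m → ℂ)) :
    TopologicalSpace (ZK K Ψ) :=
  inferInstanceAs (TopologicalSpace (Quotient (orbitSetoid K Ψ)))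

/-- The projection `U(K) → U(K)/C`. -/
def proj (K : Set (Finset (Fin m))) (Ψ : (Fin ℓ → ℂ) →ₗ[ℂ] (Fin m → ℂ)) (z : U K) : ZK K Ψ :=
  Quotient.mk (orbitSetoid K Ψ) z

/-- The action of `exp v ∈ (ℂ^×)^m` on `U(K)/C`. -/
def expActQuotient {K : Set (Finset (Fin m))} {Ψ : (Fin ℓ → ℂ) →ₗ[ℂ] (Fin m → ℂ)}
    (v : Fin m → ℂ) : ZK K Ψ → ZK K Ψ :=
  Quotient.map (sa := orbitSetoid K Ψ) (sb := orbitSetoid K Ψ) (expAct v) (by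
    rintro z w ⟨ζ, rfl⟩
    exact ⟨ζ, by ext i; simp only [expAct]; ring⟩)

/-- The given charts make `U(K)/C` a complex manifold of dimension `d` for which the projection
`U(K) → U(K)/C` is a holomorphic submersion.  This property determines the complex structure. -/
structure IsQuotientComplexStructure (d : ℕ) (K : Set (Finset (Fin m)))
    (Ψ : (Fin ℓ → ℂ) →ₗ[ℂ] (Fin m → ℂ)) [ChartedSpace (Fin d → ℂ) (ZK K Ψ)] : Prop where
  isManifold : IsManifold 𝓘(ℂ, Fin d → ℂ) ω (ZK K Ψ)
  holomorphic : ContMDiff 𝓘(ℂ, Fin m → ℂ) 𝓘(ℂ, Fin d → ℂ) ω (proj K Ψ)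
  submersion : ∀ z, Function.Surjective
    (mfderiv 𝓘(ℂ, Fin m → ℂ) 𝓘(ℂ, Fin d → ℂ) (proj K Ψ) z)

/-- The tangent distribution of the foliation `𝓕` of `Z_K = U(K)/C` by the orbits of `D = G/C`,
`G = exp(Ker A_ℂ)`: at `x` it is the image of the differential at the unit of the orbit map
`g ↦ g · x`.  The orbit map is written on `Ker A_ℂ = Lie G`, through `exp`. -/
def leafTangent {N : Type*} [NormedAddCommGroup N] [NormedSpace ℝ N] (d : ℕ) (a : Fin m → N)
    (K : Set (Finset (Fin m))) (Ψ : (Fin ℓ → ℂ) →ₗ[ℂ] (Fin m → ℂ))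
    [ChartedSpace (Fin d → ℂ) (ZK K Ψ)] : Distribution d (ZK K Ψ) :=
  fun x =>
    let orbitMap : kerAC a → ZK K Ψ := fun w => expActQuotient (w : Fin m → ℂ) x
    LinearMap.range
      (show kerAC a →L[ℂ] (Fin d → ℂ) from
        mfderiv 𝓘(ℂ, kerAC a) 𝓘(ℂ, Fin d → ℂ) orbitMap 0).toLinearMap

end Quotient

end MomentAngle

end

open Set Topology
open scoped Manifold ContDiff

noncomputable section

namespace MomentAngle

/-! ### Vertices and faces of a simple polytope. -/

section Nerve

variable {N : Type*} [NormedAddCommGroup N] [NormedSpace ℝ N] {m : ℕ}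
  {a : Fin m → N} {b : Fin m → ℝ}

/-! A dimension count shows that `Re ∘ Ψ` maps `ℂ^ℓ` isomorphically onto the real kernel `Ker A`, of
dimension `m - n = 2ℓ`. For `z ∈ U(K)`, the function `ζ ↦ ∑ (exp(2 Re Ψ(ζ)_k) |z_k|² / 2 - b_k Re
Ψ(ζ)_k)` is strictly convex, and `ζ` is critical exactly when `exp(Ψ ζ) z ∈ Z_P`
(`mem_quadricModel_iff`). The zero set of `z` is the set of inequalities tight at some `u ∈ P`, and
replacing `b` by the slacks of `u` shows that the function is proper. So every `C`-orbit meets `Z_P`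
in one point (`exists_isCritical`, `isCritical_unique`). The implicit function theorem makes this
point depend smoothly on `z`, and the resulting map `retract` descends to `φ`.

For the complex structure, write `Ker A_ℂ = q(ℂ^ℓ) ⊕ Ψ(ℂ^ℓ)`, with `q` the conjugate of `Ψ`. Take a
vertex basis `σ` containing the zero set of `z`. An element of `Ker A_ℂ` is determined by its
coordinates off `σ`, so logarithms of the `z_k`, `k ∉ σ`, give the element of `G` that brings `z` to
the slice `z_k = c_k`, `k ∉ σ`. Its `q`-component and the coordinates in `σ` of the point reached
are `ℓ + n` holomorphic functions constant along `C`-orbits. They form a chart in which `G` acts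
locally by translations of the first factor; this gives the foliation.

In such a chart `φ` is a holomorphic slice followed by `retract`. At a point `z` of `Z_P`, the
differential `L` of `retract` changes vectors by elements of `z · Ker A_ℂ` and has values
real-orthogonal to `z · Ker A`. If `h` is the component of `u` Hermitian-orthogonal to `z · Ker
A_ℂ`, this forces `L u = h + i z s` with `s ∈ Ker A`, and `ω` sees only `h`: `ω(L u, L v) = Im ⟨h_u,
h_v⟩`. Hence the pullback is `J`-invariant, nonnegative, and degenerate exactly along `z · Ker A_ℂ`,
the tangent space of the `G`-orbit. -/

theorem isClosed_polyhedron : IsClosed (polyhedron a b) := by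
  have : polyhedron a b = ⋂ i, {u : StrongDual ℝ N | 0 ≤ u (a i) + b i} := by
    ext u; simp [polyhedron]
  rw [this]
  exact isClosed_iInter fun i => isClosed_le continuous_const (by fun_prop)

/-- The inequalities tight at an extreme point of a polyhedron have spanning normals. -/
theorem span_eq_top_of_mem_extremePoints [FiniteDimensional ℝ N] {v : StrongDual ℝ N}
    (hv : v ∈ (polyhedron a b).extremePoints ℝ) :
    Submodule.span ℝ (a '' {i | v (a i) + b i = 0}) = ⊤ := by
  by_contra hne
  -- A covector killing all tight normals is a direction in which `v` can move both ways inside the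
  -- polyhedron, against extremality.
  obtain ⟨f, hf0, hf⟩ := Submodule.exists_le_ker_of_lt_top _ (lt_top_iff_ne_top.2 hne)
  let d : StrongDual ℝ N := LinearMap.toContinuousLinearMap f
  have hd0 : d ≠ 0 := by
    intro h
    apply hf0
    ext x
    exact congrArg (fun g : StrongDual ℝ N => g x) h
  have hdz : ∀ i, v (a i) + b i = 0 → d (a i) = 0 := fun i hi =>
    LinearMap.mem_ker.1 (hf (Submodule.subset_span ⟨i, hi, rfl⟩))
  have hev : ∀ᶠ t : ℝ in 𝓝 0, ∀ i, 0 ≤ (v + t • d) (a i) + b i := by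
    rw [Filter.eventually_all]
    intro i
    rcases (hv.1 i).eq_or_lt with h | h
    · refine Filter.Eventually.of_forall fun t => ?_
      simp [hdz i h.symm, ← h]
    · have hc : Continuous fun t : ℝ => (v + t • d) (a i) + b i := by
        simp only [add_apply, smul_apply, smul_eq_mul]
        fun_prop
      have := (hc.tendsto 0).eventually_const_lt (u := 0) (by simpa using h)
      exact this.mono fun t ht => ht.le
  have hev' : ∀ᶠ t : ℝ in 𝓝 0, ∀ i, 0 ≤ (v + (-t) • d) (a i) + b i :=
    (continuous_neg.tendsto' (0 : ℝ) 0 neg_zero).eventually hev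
  obtain ⟨ε, hε, hball⟩ := Metric.eventually_nhds_iff.1 (hev.and hev')
  have hε2 : dist (ε / 2) 0 < ε := by
    rw [Real.dist_eq, sub_zero, abs_of_pos (by positivity)]; linarith
  obtain ⟨h1, h2⟩ := hball hε2
  have hmem : v ∈ openSegment ℝ (v + (ε / 2) • d) (v + (-(ε / 2)) • d) :=
    ⟨1 / 2, 1 / 2, by norm_num, by norm_num, by norm_num, by module⟩
  have := hv.2 h1 h2 hmem
  have h3 : (ε / 2) • d = 0 := by simpa using this
  rcases smul_eq_zero.1 h3 with h | h
  · linarith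
  · exact hd0 h

/-- Every face of the nerve complex of a simple polytope is contained in the set of facets at
some vertex, and the normals to these facets form a basis. -/
theorem IsSimplePolytope.exists_vertex [FiniteDimensional ℝ N] (hP : IsSimplePolytope a b)
    {I : Finset (Fin m)} (hI : I ∈ nerveComplex a b) :
    ∃ (B : Finset (Fin m)) (v : StrongDual ℝ N), I ⊆ B ∧ v ∈ polyhedron a b ∧
      (∀ i, v (a i) + b i = 0 ↔ i ∈ B) ∧ LinearIndependent ℝ (fun i : B => a i) ∧
      B.card = Module.finrank ℝ N := by
  classical
  set Q : Set (StrongDual ℝ N) := {u ∈ polyhedron a b | ∀ i ∈ I, u (a i) + b i = 0} with hQ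
  have hQne : Q.Nonempty := by
    obtain ⟨u, hu, h⟩ := hI
    exact ⟨u, hu, fun i hi => (h i hi).2⟩
  have hQc : IsClosed Q := by
    have : Q = polyhedron a b ∩ ⋂ i ∈ I, {u : StrongDual ℝ N | u (a i) + b i = 0} := by
      ext u; simp [hQ]
    rw [this]
    exact isClosed_polyhedron.inter
      (isClosed_biInter fun i _ => isClosed_eq (by fun_prop) continuous_const)
  have : ProperSpace (StrongDual ℝ N) := FiniteDimensional.proper ℝ _
  have hQcpt : IsCompact Q :=
    Metric.isCompact_of_isClosed_isBounded hQc (hP.bounded.subset fun u hu => hu.1)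
  obtain ⟨v, hv⟩ := hQcpt.extremePoints_nonempty hQne
  -- `Q` is a face, so its extreme points are vertices of the polytope. Simplicity then gives `n`
  -- tight normals, and `n` spanning vectors are independent.
  have hext : IsExtreme ℝ (polyhedron a b) Q := by
    refine ⟨fun u hu => hu.1, fun x hx y hy z hz hzs => ⟨hx, fun i hi => ?_⟩⟩
    obtain ⟨s, t, hs, ht, hst, rfl⟩ := hzs
    have hzi := hz.2 i hi
    simp only [add_apply, smul_apply,
      smul_eq_mul] at hzi
    have h1 := hx i
    have h2 := hy i
    have hb : b i = s * b i + t * b i := by rw [← add_mul, hst, one_mul]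
    have h3 : s * (x (a i) + b i) + t * (y (a i) + b i) = 0 := by linarith
    have h4 := mul_nonneg hs.le h1
    have h5 := mul_nonneg ht.le h2
    have h6 : s * (x (a i) + b i) = 0 := by linarith
    exact (mul_eq_zero.1 h6).resolve_left hs.ne'
  have hvP := hext.extremePoints_subset_extremePoints hv
  let B : Finset (Fin m) := Finset.univ.filter fun i => v (a i) + b i = 0
  have hB : ∀ i, v (a i) + b i = 0 ↔ i ∈ B := fun i => by simp [B]
  have hcard : B.card = Module.finrank ℝ N := by
    rw [← hP.simple v hvP, ← Set.ncard_coe_finset]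
    congr 1
    ext i
    simp only [B, facet, Finset.coe_filter, Finset.mem_univ, true_and, mem_ofPred_eq]
    exact ⟨fun h => ⟨hvP.1, h⟩, fun h => h.2⟩
  refine ⟨B, v, fun i hi => (hB i).1 (hv.1.2 i hi), hvP.1, hB, ?_, hcard⟩
  refine linearIndependent_of_top_le_span_of_card_eq_finrank ?_ (by simp [hcard])
  rw [← span_eq_top_of_mem_extremePoints hvP]
  refine Submodule.span_mono ?_
  rintro _ ⟨i, hi, rfl⟩
  exact ⟨⟨i, (hB i).1 hi⟩, rfl⟩

/-- Every face of the nerve complex of a simple polytope is the set of all inequalities tight at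
some point of the polytope. -/
theorem IsSimplePolytope.exists_tight_iff [FiniteDimensional ℝ N] (hP : IsSimplePolytope a b)
    {I : Finset (Fin m)} (hI : I ∈ nerveComplex a b) :
    ∃ u ∈ polyhedron a b, ∀ i, u (a i) + b i = 0 ↔ i ∈ I := by
  classical
  obtain ⟨B, v, hIB, hv, hB, hli, hcard⟩ := hP.exists_vertex hI
  have hspan : ⊤ ≤ Submodule.span ℝ (range fun i : B => a i) :=
    (hli.span_eq_top_of_card_eq_finrank' (by simp [hcard])).ge
  -- This direction keeps `I` tight and makes the rest of `B` strict; inequalities outside `B`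
  -- survive a small step.
  let d : StrongDual ℝ N := LinearMap.toContinuousLinearMap
    ((Module.Basis.mk hli hspan).constr ℝ fun i : B => if (i : Fin m) ∈ I then (0 : ℝ) else 1)
  have hd : ∀ i ∈ B, d (a i) = if i ∈ I then 0 else 1 := by
    intro i hi
    have := (Module.Basis.mk hli hspan).constr_basis ℝ
      (fun i : B => if (i : Fin m) ∈ I then (0 : ℝ) else 1) ⟨i, hi⟩
    simpa [d] using this
  have hev : ∀ᶠ t : ℝ in 𝓝 0, ∀ i, i ∉ B → 0 < (v + t • d) (a i) + b i := by
    rw [Filter.eventually_all]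
    intro i
    by_cases hi : i ∈ B
    · exact Filter.Eventually.of_forall fun t h => absurd hi h
    have hpos : 0 < v (a i) + b i := lt_of_le_of_ne (hv i) fun h => hi ((hB i).1 h.symm)
    have hc : Continuous fun t : ℝ => (v + t • d) (a i) + b i := by
      simp only [add_apply, smul_apply, smul_eq_mul]
      fun_prop
    have := (hc.tendsto 0).eventually_const_lt (u := 0) (by simpa using hpos)
    exact this.mono fun t ht _ => ht
  obtain ⟨ε, hε, hball⟩ := Metric.eventually_nhds_iff.1 hev
  have hε2 : dist (ε / 2) 0 < ε := by
    rw [Real.dist_eq, sub_zero, abs_of_pos (by positivity)]; linarith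
  have h1 := hball hε2
  have hin : ∀ i ∈ B, (v + (ε / 2) • d) (a i) + b i = if i ∈ I then 0 else ε / 2 := by
    intro i hi
    have := (hB i).2 hi
    simp only [add_apply, smul_apply, smul_eq_mul,
      hd i hi]
    split_ifs <;> linarith
  refine ⟨v + (ε / 2) • d, fun i => ?_, fun i => ?_⟩
  · by_cases hi : i ∈ B
    · rw [hin i hi]; split_ifs <;> positivity
    · exact (h1 i hi).le
  · by_cases hi : i ∈ B
    · rw [hin i hi]
      by_cases hiI : i ∈ I <;> simp [hiI, hε.ne']
    · exact ⟨fun h => absurd h (h1 i hi).ne', fun h => absurd (hIB h) hi⟩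

end Nerve

/-! ### The kernel of `A_ℂ` and its splitting by `Ψ`. -/

section Kernel

variable {N : Type*} [NormedAddCommGroup N] [NormedSpace ℝ N] {m n ℓ : ℕ}
  {a : Fin m → N} {b : Fin m → ℝ} {Ψ : (Fin ℓ → ℂ) →ₗ[ℂ] (Fin m → ℂ)}

theorem IsSimplePolytope.exists_basis [FiniteDimensional ℝ N] (hP : IsSimplePolytope a b)
    (hn : Module.finrank ℝ N = n) {I : Finset (Fin m)} (hI : I ∈ nerveComplex a b) :
    ∃ σ : Fin n → Fin m, LinearIndependent ℝ (a ∘ σ) ∧ (I : Set (Fin m)) ⊆ range σ ∧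
      ∀ J : Finset (Fin m), (J : Set (Fin m)) ⊆ range σ → J ∈ nerveComplex a b := by
  obtain ⟨B, v, hIB, hv, hB, hli, hcard⟩ := hP.exists_vertex hI
  let e : Fin n ≃ B := (B.equivFinOfCardEq (hcard.trans hn)).symm
  have hr : range (fun j => (e j : Fin m)) = B := by
    ext i
    simp only [mem_range]
    exact ⟨fun ⟨j, hj⟩ => hj ▸ (e j).2, fun hi => ⟨e.symm ⟨i, hi⟩, by simp⟩⟩
  refine ⟨fun j => e j, hli.comp e e.injective, by rw [hr]; exact_mod_cast hIB, ?_⟩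
  intro J hJ
  rw [hr] at hJ
  exact ⟨v, hv, fun i hi => ⟨hv, (hB i).2 (by exact_mod_cast hJ hi)⟩⟩

theorem eq_zero_of_mem_kerAC {σ : Fin n → Fin m} (hσ : LinearIndependent ℝ (a ∘ σ))
    {w : Fin m → ℂ} (hw : w ∈ kerAC a) (h : ∀ k ∉ range σ, w k = 0) : w = 0 := by
  have hinj : Function.Injective σ := fun i j hij => hσ.injective (by simp [hij])
  have key : ∀ r : Fin m → ℝ, ∑ i, r i • a i = 0 → (∀ k ∉ range σ, r k = 0) → r = 0 := by
    intro r hr h0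
    have h1 : ∑ j, r (σ j) • (a ∘ σ) j = 0 := by
      rw [← hr]
      exact Fintype.sum_of_injective σ hinj _ _ (fun i hi => by rw [h0 i hi, zero_smul])
        fun j => rfl
    have h2 := Fintype.linearIndependent_iff.1 hσ _ h1
    ext k
    by_cases hk : k ∈ range σ
    · obtain ⟨j, rfl⟩ := hk
      exact h2 j
    · exact h0 k hk
  have hre := key _ hw.1 fun k hk => by simp [h k hk]
  have him := key _ hw.2 fun k hk => by simp [h k hk]
  ext k
  exact Complex.ext (congrFun hre k) (congrFun him k)

/-- If the vectors `a (σ j)` form a basis, an element of `Ker A_ℂ` is determined by arbitrarily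
chosen coordinates outside the range of `σ`. -/
theorem exists_lift_kerAC [FiniteDimensional ℝ N] (hn : Module.finrank ℝ N = n)
    {σ : Fin n → Fin m} (hσ : LinearIndependent ℝ (a ∘ σ)) :
    ∃ W : (Fin m → ℂ) →L[ℂ] (Fin m → ℂ), ∀ x, W x ∈ kerAC a ∧ ∀ k ∉ range σ, W x k = x k := by
  classical
  let β : Module.Basis (Fin n) ℝ N := Module.Basis.mk hσ
    (hσ.span_eq_top_of_card_eq_finrank' (by simp [hn])).ge
  have hβ : ∀ j, β j = a (σ j) := fun j => by simp [β]
  -- The relation expanding `a k` in the basis; off `range σ` its coordinates are those of the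
  -- `k`-th unit vector.
  let r : Fin m → Fin m → ℝ := fun k => Pi.single k 1 - ∑ j, β.repr (a k) j • Pi.single (σ j) 1
  let v : Fin m → Fin m → ℂ := fun k i => (r k i : ℂ)
  have hv : ∀ k, v k ∈ kerAC a := by
    intro k
    refine ⟨?_, by simp [v]⟩
    have h1 : ∑ i, r k i • a i = Fintype.linearCombination ℝ a (r k) := by
      simp [Fintype.linearCombination_apply]
    simp only [v, Complex.ofReal_re]
    rw [h1]
    simp only [r, map_sub, map_sum, map_smul, Fintype.linearCombination_apply_single, one_smul]
    rw [sub_eq_zero]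
    conv_lhs => rw [← β.sum_repr (a k)]
    simp [hβ]
  refine ⟨LinearMap.toContinuousLinearMap (Fintype.linearCombination ℂ v), fun x => ⟨?_, ?_⟩⟩
  · simp only [LinearMap.coe_toContinuousLinearMap', Fintype.linearCombination_apply]
    exact Submodule.sum_mem _ fun k _ => Submodule.smul_mem _ _ (hv k)
  · intro k hk
    have hr : ∀ i, r i k = if k = i then 1 else 0 := by
      intro i
      simp only [r, Pi.sub_apply, Finset.sum_apply, Pi.smul_apply, Pi.single_apply, smul_eq_mul]
      rw [Finset.sum_eq_zero, sub_zero]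
      intro j _
      rw [if_neg fun h => hk ⟨j, h.symm⟩, mul_zero]
    simp only [LinearMap.coe_toContinuousLinearMap', Fintype.linearCombination_apply,
      Finset.sum_apply, Pi.smul_apply, smul_eq_mul, v, hr]
    rw [Finset.sum_eq_single k]
    · rw [if_pos rfl, Complex.ofReal_one, mul_one]
    · intro i _ hi
      rw [if_neg hi.symm, Complex.ofReal_zero, mul_zero]
    · exact fun h => absurd (Finset.mem_univ k) h

/-- The imaginary relation is the real one applied to `i ζ`. -/
theorem IsAdmissible.map_mem (hΨ : IsAdmissible a Ψ) (ζ : Fin ℓ → ℂ) : Ψ ζ ∈ kerAC a := by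
  refine ⟨hΨ.comp_eq_zero ζ, ?_⟩
  have := hΨ.comp_eq_zero (Complex.I • ζ)
  simp only [map_smul, Pi.smul_apply, smul_eq_mul, Complex.mul_re, Complex.I_re, zero_mul,
    Complex.I_im, one_mul, zero_sub, neg_smul, Finset.sum_neg_distrib, neg_eq_zero] at this
  exact this

/-- The real part of `Ψ`, as a real linear map. -/
def rePart (Ψ : (Fin ℓ → ℂ) →ₗ[ℂ] (Fin m → ℂ)) : (Fin ℓ → ℂ) →ₗ[ℝ] (Fin m → ℝ) where
  toFun ζ k := (Ψ ζ k).re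
  map_add' x y := by ext; simp
  map_smul' c x := by
    ext k
    have : c • x = (c : ℂ) • x := by ext; simp
    rw [this, map_smul]
    simp

@[simp] theorem rePart_apply (ζ : Fin ℓ → ℂ) (k : Fin m) : rePart Ψ ζ k = (Ψ ζ k).re := rfl

/-- `Re ∘ Ψ` maps onto the kernel of `A`. -/
theorem IsAdmissible.exists_re_eq [FiniteDimensional ℝ N] (hΨ : IsAdmissible a Ψ)
    (hm : m = Module.finrank ℝ N + 2 * ℓ) (hspan : Submodule.span ℝ (range a) = ⊤)
    {r : Fin m → ℝ} (hr : ∑ i, r i • a i = 0) : ∃ ζ, rePart Ψ ζ = r := by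
  let A := Fintype.linearCombination ℝ a
  have hA : LinearMap.range A = ⊤ := by
    rw [← hspan]; exact Fintype.range_linearCombination ℝ a
  have hker : Module.finrank ℝ (LinearMap.ker A) = 2 * ℓ := by
    have := A.finrank_range_add_finrank_ker
    rw [hA, finrank_top, Module.finrank_fin_fun] at this
    omega
  have hmem : ∀ ζ, rePart Ψ ζ ∈ LinearMap.ker A := fun ζ => by
    simpa [A, Fintype.linearCombination_apply] using hΨ.comp_eq_zero ζ
  have hdim : Module.finrank ℝ (Fin ℓ → ℂ) = Module.finrank ℝ (LinearMap.ker A) := by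
    rw [hker, finrank_real_of_complex, Module.finrank_fin_fun]
  have hinj : Function.Injective ((rePart Ψ).codRestrict (LinearMap.ker A) hmem) := by
    intro x y hxy
    exact hΨ.injective (congrArg Subtype.val hxy)
  obtain ⟨ζ, hζ⟩ := (LinearMap.injective_iff_surjective_of_finrank_eq_finrank hdim).1 hinj
    ⟨r, by simpa [A, Fintype.linearCombination_apply] using hr⟩
  exact ⟨ζ, congrArg Subtype.val hζ⟩

/-- A decomposition `Ker A_ℂ = q(ℂ^ℓ) ⊕ Ψ(ℂ^ℓ)`, together with a linear map `p` on `ℂ^m` which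
restricts to the projection to the first summand. -/
structure Splitting (a : Fin m → N) (Ψ : (Fin ℓ → ℂ) →ₗ[ℂ] (Fin m → ℂ)) where
  q : (Fin ℓ → ℂ) →L[ℂ] (Fin m → ℂ)
  p : (Fin m → ℂ) →L[ℂ] (Fin ℓ → ℂ)
  q_mem : ∀ t, q t ∈ kerAC a
  p_q : ∀ t, p (q t) = t
  p_map : ∀ η, p (Ψ η) = 0
  exists_eq : ∀ w ∈ kerAC a, ∃ η, w = q (p w) + Ψ η

/-- The conjugate `t ↦ conj (Ψ (conj t))` of a complex linear map. -/
def conjMap (Ψ : (Fin ℓ → ℂ) →ₗ[ℂ] (Fin m → ℂ)) : (Fin ℓ → ℂ) →ₗ[ℂ] (Fin m → ℂ) where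
  toFun t := star (Ψ (star t))
  map_add' x y := by simp
  map_smul' c x := by simp [star_smul]

/-- The conjugate of `Ψ` serves as `q`. If `conj Ψ(conj t) + Ψ η = 0`, real and imaginary parts give
`Re Ψ(η + conj t) = 0` and `Re Ψ(i(η - conj t)) = 0`, so `t = η = 0`. The map `p` is a component of
a left inverse on `ℂ^m`; only its values on `Ker A_ℂ` matter. -/
theorem IsAdmissible.nonempty_splitting [FiniteDimensional ℝ N] (hΨ : IsAdmissible a Ψ)
    (hm : m = Module.finrank ℝ N + 2 * ℓ) (hspan : Submodule.span ℝ (range a) = ⊤) :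
    Nonempty (Splitting a Ψ) := by
  have hinj : ∀ ζ, (∀ k, (Ψ ζ k).re = 0) → ζ = 0 := fun ζ h =>
    hΨ.injective (by ext k; simp [h k])
  let f : (Fin ℓ → ℂ) × (Fin ℓ → ℂ) →ₗ[ℂ] (Fin m → ℂ) := (conjMap Ψ).coprod Ψ
  have hfapp : ∀ t η k, f (t, η) k = star (Ψ (star t) k) + Ψ η k := fun t η k => rfl
  have hf : LinearMap.ker f = ⊥ := by
    rw [LinearMap.ker_eq_bot']
    rintro ⟨t, η⟩ h
    have h1 : star t + η = 0 := hinj _ fun k => by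
      have := congrArg Complex.re (congrFun h k)
      rw [hfapp] at this
      simpa using this
    have h2 : Complex.I • (η - star t) = 0 := hinj _ fun k => by
      have := congrArg Complex.im (congrFun h k)
      rw [hfapp] at this
      simp only [RCLike.star_def, Complex.add_im, Complex.conj_im, Pi.zero_apply,
        Complex.zero_im] at this
      simp [map_sub]
      linarith
    have h3 : η - star t = 0 := (smul_eq_zero.1 h2).resolve_left Complex.I_ne_zero
    have h4 : η = 0 := by
      have : (2 : ℂ) • η = 0 := by
        calc (2 : ℂ) • η = (star t + η) + (η - star t) := by rw [two_smul]; abel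
          _ = 0 := by rw [h1, h3, add_zero]
      exact (smul_eq_zero.1 this).resolve_left two_ne_zero
    have h5 : t = 0 := by
      rw [h4, add_zero] at h1
      exact star_eq_zero.1 h1
    simp [h4, h5]
  obtain ⟨g, hg⟩ := LinearMap.exists_leftInverse_of_injective f hf
  have hg' : ∀ x, g (f x) = x := fun x => congrArg (fun h => h x) hg
  have hq : ∀ t, conjMap Ψ t ∈ kerAC a := fun t => by
    have h := hΨ.map_mem (star t)
    refine ⟨?_, ?_⟩
    · simpa [conjMap] using h.1
    · simpa [conjMap] using h.2
  refine ⟨⟨LinearMap.toContinuousLinearMap (conjMap Ψ),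
    LinearMap.toContinuousLinearMap (LinearMap.fst ℂ _ _ ∘ₗ g), hq, ?_, ?_, ?_⟩⟩
  · intro t
    have := hg' (t, 0)
    simp only [f, LinearMap.coprod_apply, map_zero, add_zero] at this
    simp [this]
  · intro t
    have := hg' (0, t)
    simp only [f, LinearMap.coprod_apply, map_zero, zero_add] at this
    simp [this]
  · intro w hw
    obtain ⟨ζ, hζ⟩ := hΨ.exists_re_eq hm hspan hw.1
    have hw' := (Submodule.sub_mem _ hw (hΨ.map_mem ζ)).2
    obtain ⟨ξ, hξ⟩ := hΨ.exists_re_eq hm hspan hw'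
    -- Here `w - Ψ ζ = i Re Ψ ξ`, and `Re Ψ ξ = (Ψ ξ + conj Ψ ξ) / 2` distributes it between the two
    -- summands.
    have hfw : w = f (star ((-Complex.I / 2) • ξ), ζ + (Complex.I / 2) • ξ) := by
      ext k
      have h1 := congrFun hζ k
      have h2 := congrFun hξ k
      simp only [rePart_apply, Pi.sub_apply, Complex.sub_im] at h1 h2
      rw [hfapp, star_star]
      apply Complex.ext
      · simp [Complex.mul_re, ← h1]
      · simp [Complex.mul_im]
        linarith
    refine ⟨ζ + (Complex.I / 2) • ξ, ?_⟩
    have := hg' (star ((-Complex.I / 2) • ξ), ζ + (Complex.I / 2) • ξ)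
    rw [← hfw] at this
    simp only [LinearMap.coe_toContinuousLinearMap', LinearMap.comp_apply, this,
      LinearMap.fst_apply]
    exact hfw

end Kernel

/-! ### Linear algebra of the Kähler form modulo `z · Ker A_ℂ`. -/

section Hermitian

variable {N : Type*} [NormedAddCommGroup N] [NormedSpace ℝ N] {m : ℕ} {a : Fin m → N}

theorem standardForm_apply (x y : Fin m → ℂ) :
    standardForm m ![x, y] = (∑ k, star (x k) * y k).im := by
  change ∑ k, ((x k).re * (y k).im - (x k).im * (y k).re) = _
  rw [Complex.im_sum]
  refine Finset.sum_congr rfl fun k _ => ?_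
  simp [Complex.mul_im]
  ring

/-- Orthogonal projection to `z · Ker A_ℂ`, carried out in `EuclideanSpace` because `Fin m → ℂ` has
the sup norm. -/
theorem exists_hermitian_decomposition (a : Fin m → N) (z u : Fin m → ℂ) :
    ∃ h, ∃ κ ∈ kerAC a, u = h + z * κ ∧ ∀ κ' ∈ kerAC a, ∑ k, star (z k * κ' k) * h k = 0 := by
  let S : Submodule ℂ (EuclideanSpace ℂ (Fin m)) :=
    ((kerAC a).map (LinearMap.mulLeft ℂ z : (Fin m → ℂ) →ₗ[ℂ] (Fin m → ℂ))).map
      ((WithLp.linearEquiv 2 ℂ (Fin m → ℂ)).symm : (Fin m → ℂ) →ₗ[ℂ] _)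
  obtain ⟨y, hy, h, hh, he⟩ := S.exists_add_mem_mem_orthogonal (WithLp.toLp 2 u)
  obtain ⟨_, ⟨κ, hκ, rfl⟩, rfl⟩ := hy
  refine ⟨h.ofLp, κ, hκ, ?_, fun κ' hκ' => ?_⟩
  · have := congrArg WithLp.ofLp he
    rw [add_comm h.ofLp]
    exact this
  · have := (S.mem_orthogonal h).1 hh _ ⟨_, ⟨κ', hκ', rfl⟩, rfl⟩
    rw [PiLp.inner_apply] at this
    rw [← this]
    refine Finset.sum_congr rfl fun k _ => ?_
    simp [mul_comm]

/-- A real linear map `L` that modifies vectors by elements of `z · Ker A_ℂ` and takes values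
orthogonal to `z · Ker A` is the orthogonal projection to the complement of `z · Ker A_ℂ`, up to
elements of `i z · Ker A`. -/
theorem apply_eq_of_decomposition {z : Fin m → ℂ} {L : (Fin m → ℂ) → (Fin m → ℂ)}
    (hL : ∀ u, ∃ κ ∈ kerAC a, L u = u + z * κ)
    (hL' : ∀ u, ∀ r : Fin m → ℝ, ∑ i, r i • a i = 0 → ∑ k, r k * (star (z k) * L u k).re = 0)
    {u h κ : Fin m → ℂ} (hκ : κ ∈ kerAC a) (hu : u = h + z * κ)
    (hh : ∀ κ' ∈ kerAC a, ∑ k, star (z k * κ' k) * h k = 0) :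
    ∃ s : Fin m → ℝ, (fun k => (s k : ℂ)) ∈ kerAC a ∧
      ∀ k, L u k = h k + Complex.I * (z k * s k) := by
  obtain ⟨κ₁, hκ₁, h₁⟩ := hL u
  have hκ₂ := Submodule.add_mem _ hκ hκ₁
  have hLu : ∀ k, L u k = h k + z k * ((κ + κ₁) k) := fun k => by
    rw [h₁, hu]; simp; ring
  set w := κ + κ₁
  have hr : (fun k => ((w k).re : ℂ)) ∈ kerAC a := ⟨by simpa using hκ₂.1, by simp⟩
  have hs : (fun k => ((w k).im : ℂ)) ∈ kerAC a := ⟨by simpa using hκ₂.2, by simp⟩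
  have h2 := hL' u _ hκ₂.1
  have h3 : ∑ k, (w k).re * (star (z k) * h k).re = 0 := by
    have := congrArg Complex.re (hh _ hr)
    rw [Complex.re_sum, Complex.zero_re] at this
    rw [← this]
    refine Finset.sum_congr rfl fun k _ => ?_
    simp [Complex.mul_re, Complex.mul_im]
    ring
  -- Pairing `L u = h + z w` with `z Re w` kills both `L u` and `h`, so `z Re w = 0`.
  have h4 : ∑ k, (Complex.normSq (z k) * (w k).re ^ 2) = 0 := by
    have h5 : ∑ k, (w k).re * (star (z k) * L u k).re =
        ∑ k, (w k).re * (star (z k) * h k).re + ∑ k, (Complex.normSq (z k) * (w k).re ^ 2) := by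
      rw [← Finset.sum_add_distrib]
      refine Finset.sum_congr rfl fun k _ => ?_
      rw [hLu]
      simp [Complex.mul_re, Complex.mul_im, Complex.normSq_apply]
      ring
    rw [h2, h3, zero_add] at h5
    exact h5.symm
  have h6 : ∀ k, z k * ((w k).re : ℂ) = 0 := by
    intro k
    have := (Finset.sum_eq_zero_iff_of_nonneg fun k _ =>
      mul_nonneg (Complex.normSq_nonneg _) (sq_nonneg _)).1 h4 k (Finset.mem_univ k)
    rcases mul_eq_zero.1 this with h | h
    · rw [Complex.normSq_eq_zero.1 h, zero_mul]
    · rw [pow_eq_zero_iff two_ne_zero] at h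
      simp [h]
  refine ⟨fun k => (w k).im, hs, fun k => ?_⟩
  have e : w k = (w k).re + (w k).im * Complex.I := (Complex.re_add_im _).symm
  rw [hLu]
  linear_combination z k * e + h6 k

/-- The mixed terms vanish by orthogonality, and the product of `i z s` with `i z s'` is real, hence
invisible to the imaginary part. -/
theorem standardForm_apply_of_decomposition {z h h' : Fin m → ℂ} {s s' : Fin m → ℝ}
    (hs : (fun k => (s k : ℂ)) ∈ kerAC a) (hs' : (fun k => (s' k : ℂ)) ∈ kerAC a)
    (hh : ∀ κ ∈ kerAC a, ∑ k, star (z k * κ k) * h k = 0)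
    (hh' : ∀ κ ∈ kerAC a, ∑ k, star (z k * κ k) * h' k = 0)
    {x y : Fin m → ℂ} (hx : ∀ k, x k = h k + Complex.I * (z k * s k))
    (hy : ∀ k, y k = h' k + Complex.I * (z k * s' k)) :
    standardForm m ![x, y] = (∑ k, star (h k) * h' k).im := by
  have e : ∑ k, star (x k) * y k = ∑ k, star (h k) * h' k +
      Complex.I * star (∑ k, star (z k * (s' k : ℂ)) * h k) -
      Complex.I * (∑ k, star (z k * (s k : ℂ)) * h' k) +
      ((∑ k, Complex.normSq (z k) * s k * s' k : ℝ) : ℂ) := by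
    simp only [star_sum, Finset.mul_sum, Complex.ofReal_sum]
    rw [← Finset.sum_add_distrib, ← Finset.sum_sub_distrib, ← Finset.sum_add_distrib]
    refine Finset.sum_congr rfl fun k _ => ?_
    rw [hx, hy]
    push_cast
    rw [← Complex.mul_conj]
    simp only [star_add, star_mul', RCLike.star_def, Complex.conj_I, Complex.conj_ofReal,
      Complex.conj_conj]
    linear_combination (-(z k) * (starRingEnd ℂ) (z k) * s k * s' k) * Complex.I_mul_I
  rw [standardForm_apply, e, hh _ hs', hh' _ hs]
  simp [-Complex.ofReal_sum]

/-- Since `z · Ker A_ℂ` is complex, multiplying `u` by `i` multiplies `h` by `i`, which preserves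
the Hermitian product. -/
theorem standardForm_apply_I_smul {z : Fin m → ℂ} {L : (Fin m → ℂ) → (Fin m → ℂ)}
    (hL : ∀ u, ∃ κ ∈ kerAC a, L u = u + z * κ)
    (hL' : ∀ u, ∀ r : Fin m → ℝ, ∑ i, r i • a i = 0 → ∑ k, r k * (star (z k) * L u k).re = 0)
    (u v : Fin m → ℂ) :
    standardForm m ![L (Complex.I • u), L (Complex.I • v)] = standardForm m ![L u, L v] := by
  obtain ⟨h, κ, hκ, hu, hh⟩ := exists_hermitian_decomposition a z u
  obtain ⟨h', κ', hκ', hv, hh'⟩ := exists_hermitian_decomposition a z v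
  obtain ⟨s, hs, hx⟩ := apply_eq_of_decomposition hL hL' hκ hu hh
  obtain ⟨s', hs', hy⟩ := apply_eq_of_decomposition hL hL' hκ' hv hh'
  have rot : ∀ {h : Fin m → ℂ}, (∀ κ ∈ kerAC a, ∑ k, star (z k * κ k) * h k = 0) →
      ∀ κ ∈ kerAC a, ∑ k, star (z k * κ k) * (Complex.I • h) k = 0 := by
    intro h hh κ hκ
    have := congrArg (Complex.I * ·) (hh κ hκ)
    simp only [Finset.mul_sum, mul_zero] at this
    rw [← this]
    exact Finset.sum_congr rfl fun k _ => by simp; ring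
  obtain ⟨t, ht, hx'⟩ := apply_eq_of_decomposition (h := Complex.I • h) hL hL'
    (Submodule.smul_mem _ Complex.I hκ) (u := Complex.I • u)
    (by rw [hu, smul_add, mul_smul_comm]) (rot hh)
  obtain ⟨t', ht', hy'⟩ := apply_eq_of_decomposition (h := Complex.I • h') hL hL'
    (Submodule.smul_mem _ Complex.I hκ') (u := Complex.I • v)
    (by rw [hv, smul_add, mul_smul_comm]) (rot hh')
  rw [standardForm_apply_of_decomposition hs hs' hh hh' hx hy,
    standardForm_apply_of_decomposition ht ht' (rot hh) (rot hh') hx' hy']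
  congr 1
  refine Finset.sum_congr rfl fun k _ => ?_
  simp only [Pi.smul_apply, smul_eq_mul, star_mul', RCLike.star_def, Complex.conj_I]
  linear_combination (-(starRingEnd ℂ) (h k) * h' k) * Complex.I_mul_I

/-- The value is `∑ |h_k|²`, the squared distance from `u` to `z · Ker A_ℂ`. -/
theorem standardForm_apply_self {z : Fin m → ℂ} {L : (Fin m → ℂ) → (Fin m → ℂ)}
    (hL : ∀ u, ∃ κ ∈ kerAC a, L u = u + z * κ)
    (hL' : ∀ u, ∀ r : Fin m → ℝ, ∑ i, r i • a i = 0 → ∑ k, r k * (star (z k) * L u k).re = 0)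
    (u : Fin m → ℂ) :
    0 ≤ standardForm m ![L u, L (Complex.I • u)] ∧
      (standardForm m ![L u, L (Complex.I • u)] = 0 ↔ ∃ κ ∈ kerAC a, u = z * κ) := by
  obtain ⟨h, κ, hκ, hu, hh⟩ := exists_hermitian_decomposition a z u
  obtain ⟨s, hs, hx⟩ := apply_eq_of_decomposition hL hL' hκ hu hh
  have hh₁ : ∀ κ ∈ kerAC a, ∑ k, star (z k * κ k) * (Complex.I • h) k = 0 := by
    intro κ hκ
    have := congrArg (Complex.I * ·) (hh κ hκ)
    simp only [Finset.mul_sum, mul_zero] at this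
    rw [← this]
    exact Finset.sum_congr rfl fun k _ => by simp; ring
  obtain ⟨t, ht, hx'⟩ := apply_eq_of_decomposition (h := Complex.I • h) hL hL'
    (Submodule.smul_mem _ Complex.I hκ) (u := Complex.I • u)
    (by rw [hu, smul_add, mul_smul_comm]) hh₁
  have e : standardForm m ![L u, L (Complex.I • u)] = ∑ k, Complex.normSq (h k) := by
    rw [standardForm_apply_of_decomposition hs ht hh hh₁ hx hx', Complex.im_sum]
    refine Finset.sum_congr rfl fun k _ => ?_
    simp [Complex.mul_im, Complex.normSq_apply]
  rw [e]
  refine ⟨Finset.sum_nonneg fun k _ => Complex.normSq_nonneg _, fun h0 => ⟨κ, hκ, ?_⟩, ?_⟩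
  · have : h = 0 := by
      ext k
      exact Complex.normSq_eq_zero.1 ((Finset.sum_eq_zero_iff_of_nonneg fun k _ =>
        Complex.normSq_nonneg _).1 h0 k (Finset.mem_univ k))
    rw [hu, this, zero_add]
  · rintro ⟨κ₁, hκ₁, hu₁⟩
    have h1 := hh _ (Submodule.sub_mem _ hκ₁ hκ)
    have h2 : ∀ k, z k * (κ₁ - κ) k = h k := fun k => by
      have := congrFun (hu.symm.trans hu₁) k
      simp only [Pi.add_apply, Pi.mul_apply, Pi.sub_apply] at this ⊢
      linear_combination -this
    simp only [h2] at h1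
    have h3 := congrArg Complex.re h1
    rw [Complex.re_sum, Complex.zero_re] at h3
    rw [← h3]
    refine Finset.sum_congr rfl fun k _ => ?_
    simp [Complex.mul_re, Complex.normSq_apply]

end Hermitian

/-! ### The convex function on an orbit and the retraction to the quadric model. -/

section

/-- The hypotheses on a simple polytope, its nerve complex and the map `Ψ`. -/
structure IsSetup {N : Type*} [NormedAddCommGroup N] [NormedSpace ℝ N] {m ℓ : ℕ} (n : ℕ)
    (a : Fin m → N) (b : Fin m → ℝ) (K : Set (Finset (Fin m)))
    (Ψ : (Fin ℓ → ℂ) →ₗ[ℂ] (Fin m → ℂ)) : Prop where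
  finrank_eq : Module.finrank ℝ N = n
  card_eq : m = n + 2 * ℓ
  polytope : IsSimplePolytope a b
  nerve : K = nerveComplex a b
  admissible : IsAdmissible a Ψ

/-- `ζ` is a critical point of `ζ ↦ ∑ k, exp (2 Re Ψ(ζ)_k) |z_k|² / 2 - b_k Re Ψ(ζ)_k`. -/
def IsCritical {m ℓ : ℕ} (b : Fin m → ℝ) (Ψ : (Fin ℓ → ℂ) →ₗ[ℂ] (Fin m → ℂ)) (z : Fin m → ℂ)
    (ζ : Fin ℓ → ℂ) : Prop :=
  ∀ η, ∑ k, (Real.exp (2 * (Ψ ζ k).re) * ‖z k‖ ^ 2 - b k) * (Ψ η k).re = 0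

open Classical in
/-- The parameter of the element of `C` which moves `z` to the quadric model. -/
def zeta {m ℓ : ℕ} (b : Fin m → ℝ) (Ψ : (Fin ℓ → ℂ) →ₗ[ℂ] (Fin m → ℂ)) (z : Fin m → ℂ) :
    Fin ℓ → ℂ :=
  if h : ∃ ζ, IsCritical b Ψ z ζ then h.choose else 0

/-- The projection of `U(K)` onto the quadric model along the orbits of `C`. -/
def retract {m ℓ : ℕ} (b : Fin m → ℝ) (Ψ : (Fin ℓ → ℂ) →ₗ[ℂ] (Fin m → ℂ)) (z : Fin m → ℂ) :
    Fin m → ℂ :=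
  fun k => Complex.exp (Ψ (zeta b Ψ z) k) * z k

/-- Coercivity of one summand of the convex function. For `x ≥ 0` it follows from `exp(2x) ≥ 2x²`
and the square `(A x - β)² / A ≥ 0`. -/
theorem le_exp_sub_mul {A β : ℝ} (hA : 0 < A) (hβ : 0 < β) (x : ℝ) :
    β * |x| - β ^ 2 / A ≤ Real.exp (2 * x) * A / 2 - β * x := by
  rcases le_total x 0 with hx | hx
  · rw [abs_of_nonpos hx]
    have h1 : 0 ≤ Real.exp (2 * x) * A / 2 := by positivity
    have h2 : 0 ≤ β ^ 2 / A := by positivity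
    linarith
  · rw [abs_of_nonneg hx]
    have h1 : 1 + 2 * x + (2 * x) ^ 2 / 2 ≤ Real.exp (2 * x) :=
      Real.quadratic_le_exp_of_nonneg (by positivity)
    have h2 : A * x ^ 2 ≤ Real.exp (2 * x) * A / 2 := by nlinarith
    have h3 : 0 ≤ (A * x - β) ^ 2 / A := by positivity
    have h4 : (A * x - β) ^ 2 / A = A * x ^ 2 - 2 * β * x + β ^ 2 / A := by
      field_simp
      ring
    linarith

namespace IsSetup

variable {N : Type*} [NormedAddCommGroup N] [NormedSpace ℝ N]
  {m n ℓ : ℕ} {a : Fin m → N} {b : Fin m → ℝ} {K : Set (Finset (Fin m))}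
  {Ψ : (Fin ℓ → ℂ) →ₗ[ℂ] (Fin m → ℂ)}

theorem zeros_mem {z : Fin m → ℂ} (hz : z ∈ U K) :
    (Finset.univ.filter fun k => z k = 0) ∈ K := by
  by_contra hI
  exact hz _ hI fun i hi => (Finset.mem_filter.1 hi).2

theorem exp_mul_mem {z : Fin m → ℂ} (hz : z ∈ U K) (v : Fin m → ℂ) :
    (fun k => Complex.exp (v k) * z k) ∈ U K :=
  (expAct v (⟨z, hz⟩ : U K)).2

theorem quadricModel_subset (h : IsSetup n a b K Ψ) : quadricModel a b ⊆ U K := by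
  rintro z ⟨u, hu, hz⟩ I hI h0
  rw [h.nerve] at hI
  refine hI ⟨u, hu, fun i hi => ⟨hu, ?_⟩⟩
  rw [← hz i, h0 i hi]
  simp

variable [FiniteDimensional ℝ N]

theorem span_eq_top (h : IsSetup n a b K Ψ) : Submodule.span ℝ (range a) = ⊤ := by
  obtain ⟨u, hu⟩ := h.polytope.fullDim
  obtain ⟨σ, hσ, -, -⟩ := h.polytope.exists_basis h.finrank_eq (I := ∅)
    ⟨u, interior_subset hu, by simp⟩
  rw [eq_top_iff, ← hσ.span_eq_top_of_card_eq_finrank' (by simp [h.finrank_eq])]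
  exact Submodule.span_mono (range_comp_subset_range σ a)

theorem exists_re_eq (h : IsSetup n a b K Ψ) {r : Fin m → ℝ} (hr : ∑ i, r i • a i = 0) :
    ∃ ζ, rePart Ψ ζ = r :=
  h.admissible.exists_re_eq (by rw [h.finrank_eq]; exact h.card_eq) h.span_eq_top hr

theorem nonempty_splitting (h : IsSetup n a b K Ψ) : Nonempty (Splitting a Ψ) :=
  h.admissible.nonempty_splitting (by rw [h.finrank_eq]; exact h.card_eq) h.span_eq_top

theorem exists_basis (h : IsSetup n a b K Ψ) {z : Fin m → ℂ} (hz : z ∈ U K) :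
    ∃ σ : Fin n → Fin m, LinearIndependent ℝ (a ∘ σ) ∧ (∀ k ∉ range σ, z k ≠ 0) ∧
      ∀ J : Finset (Fin m), (J : Set (Fin m)) ⊆ range σ → J ∈ K := by
  have hI := zeros_mem hz
  rw [h.nerve] at hI
  obtain ⟨σ, hσ, h1, h2⟩ := h.polytope.exists_basis h.finrank_eq hI
  exact ⟨σ, hσ, fun k hk h0 => hk (h1 (by simpa using h0)), fun J hJ => h.nerve ▸ h2 J hJ⟩

theorem eq_zero_of_forall_ne (h : IsSetup n a b K Ψ) {z : Fin m → ℂ} (hz : z ∈ U K)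
    {w : Fin m → ℂ} (hw : w ∈ kerAC a) (h0 : ∀ k, z k ≠ 0 → w k = 0) : w = 0 := by
  obtain ⟨σ, hσ, h1, -⟩ := h.exists_basis hz
  exact eq_zero_of_mem_kerAC hσ hw fun k hk => h0 k (h1 k hk)

theorem eq_zero_of_re_eq_zero (h : IsSetup n a b K Ψ) {z : Fin m → ℂ} (hz : z ∈ U K)
    {ζ : Fin ℓ → ℂ} (h0 : ∀ k, z k ≠ 0 → (Ψ ζ k).re = 0) : ζ = 0 := by
  have hw : (fun k => ((Ψ ζ k).re : ℂ)) ∈ kerAC a :=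
    ⟨by simpa using h.admissible.comp_eq_zero ζ, by simp⟩
  have h1 := h.eq_zero_of_forall_ne hz hw fun k hk => by rw [h0 k hk, Complex.ofReal_zero]
  refine h.admissible.injective ?_
  ext k
  simpa using congrFun h1 k

/-- The critical point is a minimum of a proper function. As `∑ u(a_k) Re Ψ(ζ)_k = 0`, the constants
`b_k` may be replaced by the slacks `β_k` at a point `u` of the polytope. -/
theorem exists_isCritical (h : IsSetup n a b K Ψ) {z : Fin m → ℂ} (hz : z ∈ U K) :
    ∃ ζ, IsCritical b Ψ z ζ := by
  have hI := zeros_mem hz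
  rw [h.nerve] at hI
  obtain ⟨u, hu, htight⟩ := h.polytope.exists_tight_iff hI
  -- The point `u` is chosen so that `β k` vanishes exactly when `z k` does; the linear term is then
  -- dominated in every summand.
  set β : Fin m → ℝ := fun k => u (a k) + b k with hβ
  have hβ0 : ∀ k, z k = 0 → β k = 0 := fun k hk => (htight k).2 (by simpa using hk)
  have hβpos : ∀ k, z k ≠ 0 → 0 < β k := fun k hk =>
    lt_of_le_of_ne (hu k) fun h0 => hk (by simpa using (htight k).1 h0.symm)
  let f : (Fin ℓ → ℂ) → ℝ := fun ζ =>
    ∑ k, (Real.exp (2 * rePart Ψ ζ k) * ‖z k‖ ^ 2 / 2 - β k * rePart Ψ ζ k)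
  have hcont : Continuous (rePart Ψ) := (rePart Ψ).continuous_of_finiteDimensional
  have hck : ∀ k, Continuous fun ζ => rePart Ψ ζ k := fun k => (continuous_apply k).comp hcont
  have hf : Continuous f := by
    refine continuous_finsetSum _ fun k _ => ?_
    have := hck k
    fun_prop
  let T : (Fin ℓ → ℂ) →ₗ[ℝ] (Fin m → ℝ) :=
    LinearMap.pi fun k => β k • (LinearMap.proj k ∘ₗ rePart Ψ)
  have hT : ∀ ζ k, T ζ k = β k * rePart Ψ ζ k := fun ζ k => rfl
  have hTker : LinearMap.ker T = ⊥ := by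
    rw [LinearMap.ker_eq_bot']
    intro ζ hζ
    refine h.eq_zero_of_re_eq_zero hz fun k hk => ?_
    have := congrFun hζ k
    rw [hT] at this
    exact (mul_eq_zero.1 this).resolve_left (hβpos k hk).ne'
  have hlow : ∀ ζ, ‖T ζ‖ - ∑ k, β k ^ 2 / ‖z k‖ ^ 2 ≤ f ζ := by
    intro ζ
    have h1 : ‖T ζ‖ ≤ ∑ k, β k * |rePart Ψ ζ k| := by
      refine (pi_norm_le_iff_of_nonneg (Finset.sum_nonneg fun k _ =>
        mul_nonneg (hu k) (abs_nonneg _))).2 fun k => ?_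
      rw [hT, Real.norm_eq_abs, abs_mul, abs_of_nonneg (hu k)]
      exact Finset.single_le_sum (f := fun k => β k * |rePart Ψ ζ k|)
        (fun k _ => mul_nonneg (hu k) (abs_nonneg _)) (Finset.mem_univ k)
    have h2 : ∑ k, (β k * |rePart Ψ ζ k| - β k ^ 2 / ‖z k‖ ^ 2) ≤ f ζ := by
      refine Finset.sum_le_sum fun k _ => ?_
      by_cases hk : z k = 0
      · simp [hk, hβ0 k hk]
      · exact le_exp_sub_mul (pow_pos (norm_pos_iff.2 hk) 2) (hβpos k hk) _
    rw [Finset.sum_sub_distrib] at h2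
    linarith
  have hlim : Filter.Tendsto f (Filter.cocompact _) Filter.atTop := by
    refine Filter.tendsto_atTop_mono hlow (Filter.tendsto_atTop_add_const_right _ _ ?_)
    exact (tendsto_norm_cocompact_atTop (E := Fin m → ℝ)).comp
      (LinearMap.isClosedEmbedding_of_injective hTker).tendsto_cocompact
  obtain ⟨ζ, hζ⟩ := hf.exists_forall_le hlim
  refine ⟨ζ, fun η => ?_⟩
  have hder : HasDerivAt (fun t : ℝ => f (ζ + t • η))
      (∑ k, (Real.exp (2 * (Ψ ζ k).re) * ‖z k‖ ^ 2 - β k) * (Ψ η k).re) 0 := by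
    refine HasDerivAt.fun_sum fun k _ => ?_
    have h1 : HasDerivAt (fun t : ℝ => rePart Ψ (ζ + t • η) k) ((Ψ η k).re) 0 := by
      have : (fun t : ℝ => rePart Ψ (ζ + t • η) k) =
          fun t : ℝ => (Ψ ζ k).re + t * (Ψ η k).re := by
        ext t; simp only [map_add, map_smul]; simp
      rw [this]
      simpa using ((hasDerivAt_id (0 : ℝ)).mul_const ((Ψ η k).re)).const_add ((Ψ ζ k).re)
    have h2 := (((h1.const_mul 2).exp.mul_const (‖z k‖ ^ 2)).div_const 2).sub
      (h1.const_mul (β k))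
    refine h2.congr_deriv ?_
    simp only [zero_smul, add_zero, rePart_apply]
    ring
  have hmin : IsLocalMin (fun t : ℝ => f (ζ + t • η)) 0 :=
    Filter.Eventually.of_forall fun t => by simpa using hζ (ζ + t • η)
  have h0 := hmin.hasDerivAt_eq_zero hder
  have h1 : ∑ k, u (a k) * (Ψ η k).re = 0 := by
    have := congrArg u (h.admissible.comp_eq_zero η)
    rw [map_sum, map_zero] at this
    rw [← this]
    exact Finset.sum_congr rfl fun k _ => by rw [map_smul, smul_eq_mul, mul_comm]
  rw [← h0, ← sub_eq_zero, ← Finset.sum_sub_distrib, ← h1]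
  refine Finset.sum_congr rfl fun k _ => ?_
  simp only [hβ]
  ring

/-- Monotonicity of `exp`, with `ζ - η` as test vector in both equations, gives equal real parts
where `z k ≠ 0`; these coordinates determine an element of `Ker A`. -/
theorem isCritical_unique (h : IsSetup n a b K Ψ) {z : Fin m → ℂ} (hz : z ∈ U K)
    {ζ η : Fin ℓ → ℂ} (hζ : IsCritical b Ψ z ζ) (hη : IsCritical b Ψ z η) : ζ = η := by
  rw [← sub_eq_zero]
  have h1 : ∑ k, ((Real.exp (2 * (Ψ ζ k).re) - Real.exp (2 * (Ψ η k).re)) *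
      ((Ψ ζ k).re - (Ψ η k).re)) * ‖z k‖ ^ 2 = 0 := by
    have h2 := hζ (ζ - η)
    have h3 := hη (ζ - η)
    rw [← sub_eq_zero.2 (h2.trans h3.symm), ← Finset.sum_sub_distrib]
    refine Finset.sum_congr rfl fun k _ => ?_
    simp only [map_sub, Pi.sub_apply, Complex.sub_re]
    ring
  have hpos : ∀ x y : ℝ, 0 ≤ (Real.exp (2 * x) - Real.exp (2 * y)) * (x - y) := by
    intro x y
    rcases le_total x y with hxy | hxy
    · exact mul_nonneg_of_nonpos_of_nonpos
        (sub_nonpos.2 (Real.exp_le_exp.2 (by linarith))) (sub_nonpos.2 hxy)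
    · exact mul_nonneg (sub_nonneg.2 (Real.exp_le_exp.2 (by linarith))) (sub_nonneg.2 hxy)
  refine h.eq_zero_of_re_eq_zero hz fun k hk => ?_
  have h2 := (Finset.sum_eq_zero_iff_of_nonneg fun k _ =>
    mul_nonneg (hpos _ _) (sq_nonneg _)).1 h1 k (Finset.mem_univ k)
  rcases mul_eq_zero.1 h2 with h3 | h3
  · rw [map_sub, Pi.sub_apply, Complex.sub_re]
    rcases mul_eq_zero.1 h3 with h4 | h4
    · have := Real.exp_injective (sub_eq_zero.1 h4)
      linarith
    · exact h4
  · exact absurd (norm_eq_zero.1 (pow_eq_zero_iff two_ne_zero |>.1 h3)) hk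

theorem isCritical_zeta (h : IsSetup n a b K Ψ) {z : Fin m → ℂ} (hz : z ∈ U K) :
    IsCritical b Ψ z (zeta b Ψ z) := by
  have := h.exists_isCritical hz
  rw [zeta, dif_pos this]
  exact this.choose_spec

theorem zeta_eq (h : IsSetup n a b K Ψ) {z : Fin m → ℂ} (hz : z ∈ U K) {ζ : Fin ℓ → ℂ}
    (hζ : IsCritical b Ψ z ζ) : zeta b Ψ z = ζ :=
  h.isCritical_unique hz (h.isCritical_zeta hz) hζ

/-- Criticality at `0` says that `|z|² - b` annihilates `Re Ψ(ℂ^ℓ) = Ker A`, so it lies in the image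
of the dual of `A`. The inequalities defining `P` hold because `|z_k|² ≥ 0`. -/
theorem mem_quadricModel_iff (h : IsSetup n a b K Ψ) {z : Fin m → ℂ} :
    z ∈ quadricModel a b ↔ IsCritical b Ψ z 0 := by
  constructor
  · rintro ⟨u, -, hz⟩ η
    have := congrArg u (h.admissible.comp_eq_zero η)
    rw [map_sum, map_zero] at this
    rw [← this]
    refine Finset.sum_congr rfl fun k _ => ?_
    rw [hz k]
    simp [mul_comm]
  · intro hz
    let A := Fintype.linearCombination ℝ a
    let c : Module.Dual ℝ (Fin m → ℝ) :=
      Fintype.linearCombination ℝ fun k => ‖z k‖ ^ 2 - b k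
    have hc : c ∈ (LinearMap.ker A).dualAnnihilator := by
      rw [Submodule.mem_dualAnnihilator]
      intro r hr
      obtain ⟨η, rfl⟩ := h.exists_re_eq (r := r)
        (by simpa [A, Fintype.linearCombination_apply] using hr)
      have := hz η
      simp only [map_zero, Pi.zero_apply, Complex.zero_re, mul_zero, Real.exp_zero,
        one_mul] at this
      rw [← this]
      simp [c, Fintype.linearCombination_apply, mul_comm]
    rw [← LinearMap.range_dualMap_eq_dualAnnihilator_ker] at hc
    obtain ⟨f, hf⟩ := hc
    have hfa : ∀ k, f (a k) = ‖z k‖ ^ 2 - b k := by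
      intro k
      have := congrArg (fun g : Module.Dual ℝ (Fin m → ℝ) => g (Pi.single k 1)) hf
      simpa [A, c, LinearMap.dualMap_apply, Fintype.linearCombination_apply_single] using this
    have hz' : ∀ k, ‖z k‖ ^ 2 = LinearMap.toContinuousLinearMap f (a k) + b k := fun k => by
      simp [hfa]
    exact ⟨LinearMap.toContinuousLinearMap f, fun k => hz' k ▸ sq_nonneg _, hz'⟩

theorem zeta_exp_mul (h : IsSetup n a b K Ψ) {z : Fin m → ℂ} (hz : z ∈ U K) (η : Fin ℓ → ℂ) :
    zeta b Ψ (fun k => Complex.exp (Ψ η k) * z k) = zeta b Ψ z - η := by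
  refine h.zeta_eq (exp_mul_mem hz _) fun ξ => ?_
  rw [← h.isCritical_zeta hz ξ]
  refine Finset.sum_congr rfl fun k _ => ?_
  rw [norm_mul, mul_pow, ← mul_assoc, Complex.norm_exp, ← Real.exp_nat_mul, ← Real.exp_add]
  congr 4
  simp only [map_sub, Pi.sub_apply, Complex.sub_re]
  push_cast
  ring

theorem retract_exp_mul (h : IsSetup n a b K Ψ) {z : Fin m → ℂ} (hz : z ∈ U K)
    (η : Fin ℓ → ℂ) : retract b Ψ (fun k => Complex.exp (Ψ η k) * z k) = retract b Ψ z := by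
  ext k
  rw [retract, h.zeta_exp_mul hz, retract, ← mul_assoc, ← Complex.exp_add, map_sub,
    Pi.sub_apply, sub_add_cancel]

theorem retract_mem (h : IsSetup n a b K Ψ) {z : Fin m → ℂ} (hz : z ∈ U K) :
    retract b Ψ z ∈ quadricModel a b := by
  rw [h.mem_quadricModel_iff]
  have := h.isCritical_zeta (exp_mul_mem hz (Ψ (zeta b Ψ z)))
  rwa [h.zeta_exp_mul hz, sub_self] at this

theorem zeta_of_mem (h : IsSetup n a b K Ψ) {z : Fin m → ℂ} (hz : z ∈ quadricModel a b) :
    zeta b Ψ z = 0 :=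
  h.zeta_eq (h.quadricModel_subset hz) (h.mem_quadricModel_iff.1 hz)

theorem retract_of_mem (h : IsSetup n a b K Ψ) {z : Fin m → ℂ} (hz : z ∈ quadricModel a b) :
    retract b Ψ z = z := by
  ext k
  simp [retract, h.zeta_of_mem hz]

/-- Implicit function theorem for the gradient `F`; uniqueness of critical points identifies the
implicit function with `zeta`. -/
theorem contDiffAt_zeta (h : IsSetup n a b K Ψ) {z₀ : Fin m → ℂ} (hz₀ : z₀ ∈ U K) :
    ContDiffAt ℝ ∞ (zeta b Ψ) z₀ := by
  let ρ : Fin m → StrongDual ℝ (Fin ℓ → ℂ) := fun k =>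
    LinearMap.toContinuousLinearMap (LinearMap.proj k ∘ₗ rePart Ψ)
  have hρ : ∀ k ζ, ρ k ζ = (Ψ ζ k).re := fun k ζ => rfl
  let F : (Fin m → ℂ) × (Fin ℓ → ℂ) → StrongDual ℝ (Fin ℓ → ℂ) := fun x =>
    ∑ k, (Real.exp (2 * ρ k x.2) * ‖x.1 k‖ ^ 2 - b k) • ρ k
  have hF0 : ∀ z ζ, F (z, ζ) = 0 ↔ IsCritical b Ψ z ζ := by
    intro z ζ
    rw [ContinuousLinearMap.ext_iff]
    refine forall_congr' fun η => ?_
    simp [F, hρ]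
  have hF : ContDiff ℝ ∞ F := by
    refine ContDiff.sum fun k _ => ContDiff.fun_smul (ContDiff.sub (ContDiff.mul ?_ ?_)
      contDiff_const) contDiff_const
    · exact Real.contDiff_exp.comp (contDiff_const.mul ((ρ k).contDiff.comp contDiff_snd))
    · exact (contDiff_norm_sq ℝ).comp ((contDiff_apply ℝ ℂ k).comp contDiff_fst)
  set ζ₀ := zeta b Ψ z₀
  have hcrit : F (z₀, ζ₀) = 0 := (hF0 _ _).2 (h.isCritical_zeta hz₀)
  let F' : (Fin ℓ → ℂ) →L[ℝ] StrongDual ℝ (Fin ℓ → ℂ) :=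
    ∑ k, ((2 * Real.exp (2 * ρ k ζ₀) * ‖z₀ k‖ ^ 2) • ρ k).smulRight (ρ k)
  have hF' : HasFDerivAt (fun ζ => F (z₀, ζ)) F' ζ₀ := by
    refine HasFDerivAt.fun_sum fun k _ => ?_
    have h1 : HasFDerivAt (fun ζ => Real.exp (2 * ρ k ζ) * ‖z₀ k‖ ^ 2 - b k)
        ((2 * Real.exp (2 * ρ k ζ₀) * ‖z₀ k‖ ^ 2) • ρ k) ζ₀ := by
      have := ((((ρ k).hasFDerivAt (x := ζ₀)).const_mul 2).exp.mul_const
        (‖z₀ k‖ ^ 2)).sub_const (b k)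
      refine this.congr_fderiv ?_
      ext η
      simp
      ring
    exact h1.smul_const (ρ k)
  have hfd : fderiv ℝ F (z₀, ζ₀) ∘L ContinuousLinearMap.inr ℝ (Fin m → ℂ) (Fin ℓ → ℂ) = F' := by
    have h1 := ((hF.differentiable (by simp)) (z₀, ζ₀)).hasFDerivAt.comp ζ₀
      (hasFDerivAt_prodMk_right z₀ ζ₀)
    exact h1.unique hF'
  -- `F'` is the Hessian, with quadratic form `∑ 2 exp(2 Re Ψ(ζ₀)_k) |z_k|² (Re Ψ(η)_k)²`, which is
  -- definite on `U(K)`.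
  have hinj : Function.Injective F' := by
    rw [injective_iff_map_eq_zero]
    intro η hη
    refine h.eq_zero_of_re_eq_zero hz₀ fun k hk => ?_
    have h1 : ∑ k, 2 * Real.exp (2 * ρ k ζ₀) * ‖z₀ k‖ ^ 2 * (ρ k η) ^ 2 = 0 := by
      have := congrArg (fun g : StrongDual ℝ (Fin ℓ → ℂ) => g η) hη
      simp only [zero_apply] at this
      rw [← this]
      simp only [F', sum_apply, ContinuousLinearMap.smulRight_apply, smul_apply, smul_eq_mul]
      exact Finset.sum_congr rfl fun k _ => by ring
    have h2 := (Finset.sum_eq_zero_iff_of_nonneg fun k _ => by positivity).1 h1 k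
      (Finset.mem_univ k)
    have h3 : 2 * Real.exp (2 * ρ k ζ₀) * ‖z₀ k‖ ^ 2 ≠ 0 := by
      have := norm_pos_iff.2 hk
      positivity
    exact pow_eq_zero_iff two_ne_zero |>.1 ((mul_eq_zero.1 h2).resolve_left h3)
  have hdim : Module.finrank ℝ (Fin ℓ → ℂ) =
      Module.finrank ℝ (StrongDual ℝ (Fin ℓ → ℂ)) := by
    rw [← (LinearMap.toContinuousLinearMap (𝕜 := ℝ) (E := Fin ℓ → ℂ) (F' := ℝ)).finrank_eq]
    exact (Subspace.dual_finrank_eq (K := ℝ) (V := Fin ℓ → ℂ)).symm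
  have hinv : F'.IsInvertible :=
    ⟨(LinearEquiv.ofInjectiveOfFinrankEq F'.toLinearMap hinj hdim).toContinuousLinearEquiv,
      by ext; rfl⟩
  have hif : (fderiv ℝ F (z₀, ζ₀) ∘L
      ContinuousLinearMap.inr ℝ (Fin m → ℂ) (Fin ℓ → ℂ)).IsInvertible := hfd ▸ hinv
  have hFat : ContDiffAt ℝ ∞ F (z₀, ζ₀) := hF.contDiffAt
  refine (hFat.contDiffAt_implicitFunction (by simp) hif).congr_of_eventuallyEq ?_
  filter_upwards [hFat.eventually_apply_implicitFunction (by simp) hif,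
    (U K).isOpen.mem_nhds hz₀] with z hz hzU
  exact h.zeta_eq hzU ((hF0 _ _).1 (hz.trans hcrit))

theorem contDiffAt_retract (h : IsSetup n a b K Ψ) {z : Fin m → ℂ} (hz : z ∈ U K) :
    ContDiffAt ℝ ∞ (retract b Ψ) z := by
  refine contDiffAt_pi.2 fun k => ContDiffAt.mul ?_ (contDiff_apply ℝ ℂ k).contDiffAt
  let L : (Fin ℓ → ℂ) →L[ℝ] ℂ :=
    LinearMap.toContinuousLinearMap ((LinearMap.proj k ∘ₗ Ψ).restrictScalars ℝ)
  exact Complex.contDiff_exp.contDiffAt.comp z (L.contDiff.contDiffAt.comp z (h.contDiffAt_zeta hz))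

end IsSetup

end

/-! ### Holomorphic charts from vertex bases and logarithms. -/

section

/-- An identification `ℂ^ℓ × ℂ^n ≃ ℂ^(n + ℓ)`. -/
def coordEquiv (n ℓ : ℕ) : ((Fin ℓ → ℂ) × (Fin n → ℂ)) ≃L[ℂ] (Fin (n + ℓ) → ℂ) :=
  ContinuousLinearEquiv.ofFinrankEq (by simp [add_comm])

/-- The data of a chart of `U(K)/C`: a face `σ` of `K` such that the vectors `a (σ j)` form a
basis, and a basepoint `c`. -/
structure ChartData {N : Type*} [NormedAddCommGroup N] [NormedSpace ℝ N] {m : ℕ} (n : ℕ)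
    (a : Fin m → N) (K : Set (Finset (Fin m))) where
  σ : Fin n → Fin m
  li : LinearIndependent ℝ (a ∘ σ)
  mem : ∀ J : Finset (Fin m), (J : Set (Fin m)) ⊆ range σ → J ∈ K
  c : Fin m → ℂ
  c_ne : ∀ k, c k ≠ 0
  W : (Fin m → ℂ) →L[ℂ] (Fin m → ℂ)
  W_mem : ∀ x, W x ∈ kerAC a
  W_apply : ∀ x, ∀ k ∉ range σ, W x k = x k

/-- Two logarithms differ by a multiple of `2πi`; continuity and agreement at `x` force this
multiple to be zero nearby. -/
theorem eventuallyEq_of_exp_eq {X : Type*} [TopologicalSpace X] {f g : X → ℂ} {x : X}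
    (hf : ContinuousAt f x) (hg : ContinuousAt g x) (hx : f x = g x)
    (h : ∀ᶠ y in 𝓝 x, Complex.exp (f y) = Complex.exp (g y)) : f =ᶠ[𝓝 x] g := by
  have hc : ContinuousAt (fun y => |(f y - g y).im|) x :=
    (Complex.continuous_im.continuousAt.comp (hf.sub hg)).abs
  have h1 : ∀ᶠ y in 𝓝 x, |(f y - g y).im| < 2 * Real.pi := by
    refine hc.eventually_lt_const ?_
    simp [hx, Real.pi_pos]
  filter_upwards [h, h1] with y hy hy1
  obtain ⟨j, hj⟩ := Complex.exp_eq_exp_iff_exists_int.1 hy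
  have h2 : (f y - g y).im = j * (2 * Real.pi) := by
    rw [hj]; simp
  rw [h2, abs_mul, abs_of_pos Real.two_pi_pos] at hy1
  have h3 : |(j : ℝ)| < 1 := by
    have := Real.two_pi_pos
    by_contra h
    nlinarith [not_lt.1 h]
  have h4 : j = 0 := by
    rw [← Int.cast_abs, ← Int.cast_one, Int.cast_lt, Int.abs_lt_one_iff] at h3
    exact h3
  rw [hj, h4]
  simp

namespace ChartData

variable {N : Type*} [NormedAddCommGroup N] [NormedSpace ℝ N]
  {m n ℓ : ℕ} {a : Fin m → N} {b : Fin m → ℝ} {K : Set (Finset (Fin m))}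
  {Ψ : (Fin ℓ → ℂ) →ₗ[ℂ] (Fin m → ℂ)}

theorem injective (D : ChartData n a K) : Function.Injective D.σ := fun i j hij =>
  D.li.injective (by simp [hij])

theorem W_eq (D : ChartData n a K) {x w : Fin m → ℂ} (hw : w ∈ kerAC a)
    (hx : ∀ k ∉ range D.σ, x k = w k) : D.W x = w := by
  rw [← sub_eq_zero]
  refine eq_zero_of_mem_kerAC D.li (Submodule.sub_mem _ (D.W_mem x) hw) fun k hk => ?_
  rw [Pi.sub_apply, D.W_apply x k hk, hx k hk, sub_self]

theorem W_congr (D : ChartData n a K) {x y : Fin m → ℂ} (h : ∀ k ∉ range D.σ, x k = y k) :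
    D.W x = D.W y :=
  D.W_eq (D.W_mem y) fun k hk => (h k hk).trans (D.W_apply y k hk).symm

/-- The domain of the chart, as a subset of the quadric model. -/
def dom (D : ChartData n a K) : Set (Fin m → ℂ) :=
  {z | ∀ k ∉ range D.σ, 0 < (z k / D.c k).re}

/-- The logarithmic coordinate on the domain of the chart. -/
def logCoord (D : ChartData n a K) (z : Fin m → ℂ) : Fin m → ℂ :=
  D.W fun k => Complex.log (z k / D.c k)

/-- The chart, as a function on the quadric model. -/
def coord (D : ChartData n a K) (s : Splitting a Ψ) (z : Fin m → ℂ) : Fin (n + ℓ) → ℂ :=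
  coordEquiv n ℓ (s.p (D.logCoord z),
    fun j => Complex.exp (-D.logCoord z (D.σ j)) * z (D.σ j))

/-- The holomorphic slice defining the inverse of the chart. -/
def slice (D : ChartData n a K) (s : Splitting a Ψ) (v : Fin (n + ℓ) → ℂ) : Fin m → ℂ :=
  fun k => Complex.exp (s.q ((coordEquiv n ℓ).symm v).1 k) *
    Function.extend D.σ ((coordEquiv n ℓ).symm v).2 D.c k

/-- The range of the chart. -/
def target (D : ChartData n a K) (s : Splitting a Ψ) (b : Fin m → ℝ) :
    Set (Fin (n + ℓ) → ℂ) :=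
  {v | ∀ k ∉ range D.σ,
    |(Ψ (zeta b Ψ (D.slice s v)) k + s.q ((coordEquiv n ℓ).symm v).1 k).im| < Real.pi / 2}

theorem slice_mem (D : ChartData n a K) (s : Splitting a Ψ) (v : Fin (n + ℓ) → ℂ) :
    D.slice s v ∈ U K := by
  intro I hI h0
  refine hI (D.mem I fun k hk => ?_)
  by_contra hkσ
  have := h0 k hk
  rw [slice, Function.extend_apply' _ _ _ hkσ] at this
  exact mul_ne_zero (Complex.exp_ne_zero _) (D.c_ne k) this

theorem contDiff_slice (D : ChartData n a K) (s : Splitting a Ψ) :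
    ContDiff ℂ ω (D.slice s) := by
  refine contDiff_pi.2 fun k => ContDiff.mul (Complex.contDiff_exp.comp ?_) ?_
  · exact (contDiff_apply ℂ ℂ k).comp (s.q.contDiff.comp
      (contDiff_fst.comp (coordEquiv n ℓ).symm.contDiff))
  · by_cases hk : k ∈ range D.σ
    · obtain ⟨j, rfl⟩ := hk
      simp only [D.injective.extend_apply]
      exact (contDiff_apply ℂ ℂ j).comp (contDiff_snd.comp (coordEquiv n ℓ).symm.contDiff)
    · simp only [Function.extend_apply' _ _ _ hk]
      exact contDiff_const

theorem contDiff_exp_mul_slice (D : ChartData n a K) (s : Splitting a Ψ) (η : Fin ℓ → ℂ) :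
    ContDiff ℂ ω fun v k => Complex.exp (Ψ η k) * D.slice s v k :=
  contDiff_pi.2 fun k => contDiff_const.mul ((contDiff_apply ℂ ℂ k).comp (D.contDiff_slice s))

theorem isOpen_dom (D : ChartData n a K) : IsOpen D.dom := by
  have : D.dom = ⋂ k : Fin m, ⋂ _ : k ∉ range D.σ, {z | 0 < (z k / D.c k).re} := by
    ext z; simp [dom]
  rw [this]
  refine isOpen_iInter_of_finite fun k => isOpen_iInter_of_finite fun _ => ?_
  exact isOpen_lt continuous_const
    (Complex.continuous_re.comp ((continuous_apply k).div_const _))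

theorem continuousOn_logCoord (D : ChartData n a K) : ContinuousOn D.logCoord D.dom := by
  intro z hz
  -- `W` ignores the coordinates in `range σ`, where `z k` may vanish and the logarithm need not be
  -- continuous.
  have h1 : D.logCoord = fun z => D.W fun k =>
      haveI := Classical.propDecidable (k ∈ range D.σ)
      if k ∈ range D.σ then 0 else Complex.log (z k / D.c k) := by
    funext z
    exact D.W_congr fun k hk => by rw [if_neg hk]
  rw [h1]
  refine ContinuousAt.continuousWithinAt (D.W.continuous.continuousAt.comp
    (continuousAt_pi.2 fun k => ?_))
  by_cases hk : k ∈ range D.σ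
  · simp only [if_pos hk]
    exact continuousAt_const
  · simp only [if_neg hk]
    exact ((continuous_apply k).div_const _).continuousAt.clog (Or.inl (hz k hk))

theorem continuousOn_coord (D : ChartData n a K) (s : Splitting a Ψ) :
    ContinuousOn (D.coord s) D.dom := by
  have h := D.continuousOn_logCoord
  refine (coordEquiv n ℓ).continuous.comp_continuousOn
    ((s.p.continuous.comp_continuousOn h).prodMk (continuousOn_pi.2 fun j => ?_))
  exact (((continuous_apply (D.σ j)).comp_continuousOn h).neg.cexp).mul
    (continuous_apply (D.σ j)).continuousOn

theorem retract_slice_apply (D : ChartData n a K) (s : Splitting a Ψ) (b : Fin m → ℝ)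
    (v : Fin (n + ℓ) → ℂ) (k : Fin m) :
    retract b Ψ (D.slice s v) k =
      Complex.exp ((Ψ (zeta b Ψ (D.slice s v)) + s.q ((coordEquiv n ℓ).symm v).1) k) *
        Function.extend D.σ ((coordEquiv n ℓ).symm v).2 D.c k := by
  rw [retract, Pi.add_apply, Complex.exp_add, mul_assoc]
  rfl

theorem retract_slice_mem_dom (D : ChartData n a K) (s : Splitting a Ψ)
    {v : Fin (n + ℓ) → ℂ} (hv : v ∈ D.target s b) : retract b Ψ (D.slice s v) ∈ D.dom := by
  intro k hk
  rw [D.retract_slice_apply, Function.extend_apply' _ _ _ hk,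
    mul_div_cancel_right₀ _ (D.c_ne k), Complex.exp_re]
  exact mul_pos (Real.exp_pos _) (Real.cos_pos_of_mem_Ioo (abs_lt.1 (hv k hk)))

/-- Acting by `exp (-logCoord z)` brings `z` to the slice, and `slice` restores only the
`q`-component of the exponent. The missing factor lies in `C`. -/
theorem exists_slice_coord (D : ChartData n a K) (s : Splitting a Ψ)
    {z : Fin m → ℂ} (hz : z ∈ D.dom) :
    ∃ η, D.slice s (D.coord s z) = (fun k => Complex.exp (Ψ (-η) k) * z k) ∧
      D.logCoord z = s.q (s.p (D.logCoord z)) + Ψ η := by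
  obtain ⟨η, hη⟩ := s.exists_eq _ (D.W_mem fun k => Complex.log (z k / D.c k))
  refine ⟨η, ?_, hη⟩
  change D.logCoord z = s.q (s.p (D.logCoord z)) + Ψ η at hη
  ext k
  have hk' := congrFun hη k
  rw [Pi.add_apply] at hk'
  rw [slice, coord, ContinuousLinearEquiv.symm_apply_apply]
  simp only
  by_cases hk : k ∈ range D.σ
  · obtain ⟨j, rfl⟩ := hk
    rw [D.injective.extend_apply, ← mul_assoc, ← Complex.exp_add, map_neg, Pi.neg_apply]
    congr 2
    linear_combination -hk'
  · have hne : z k / D.c k ≠ 0 := fun h0 => by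
      have := hz k hk
      simp [h0] at this
    have h1 : D.logCoord z k = Complex.log (z k / D.c k) := D.W_apply _ k hk
    have h2 : z k = Complex.exp (D.logCoord z k) * D.c k := by
      rw [h1, Complex.exp_log hne, div_mul_cancel₀ _ (D.c_ne k)]
    rw [Function.extend_apply' _ _ _ hk]
    conv_rhs => rw [h2]
    rw [← mul_assoc, ← Complex.exp_add, map_neg, Pi.neg_apply]
    congr 2
    linear_combination -hk'

/-- A holomorphic expression for the chart near `z`. -/
def germ (D : ChartData n a K) (s : Splitting a Ψ) (z C z' : Fin m → ℂ) : Fin (n + ℓ) → ℂ :=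
  coordEquiv n ℓ (s.p (D.W fun k => Complex.log (z' k / z k) + C k),
    fun j => Complex.exp (-D.W (fun k => Complex.log (z' k / z k) + C k) (D.σ j)) * z' (D.σ j))

theorem contDiffAt_germ (D : ChartData n a K) (s : Splitting a Ψ) (z C : Fin m → ℂ) :
    ContDiffAt ℂ ω (D.germ s z C) z := by
  have hW : ContDiffAt ℂ ω (fun z' : Fin m → ℂ => D.W fun k => Complex.log (z' k / z k) + C k)
      z := by
    refine D.W.contDiff.contDiffAt.comp z (contDiffAt_pi.2 fun k => ?_)
    refine ContDiffAt.add ?_ contDiffAt_const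
    -- Division by zero makes this coordinate a constant.
    by_cases hk : z k = 0
    · simp only [hk, div_zero]
      exact contDiffAt_const
    · refine ContDiffAt.comp z (Complex.contDiffAt_log ?_)
        ((contDiff_apply ℂ ℂ k).contDiffAt.div_const _)
      rw [div_self hk]
      exact Complex.one_mem_slitPlane
  refine (coordEquiv n ℓ).contDiff.contDiffAt.comp z
    ((s.p.contDiff.contDiffAt.comp z hW).prodMk (contDiffAt_pi.2 fun j => ?_))
  exact (((contDiff_apply ℂ ℂ (D.σ j)).contDiffAt.comp z hW).neg.cexp).mul
    (contDiff_apply ℂ ℂ (D.σ j)).contDiffAt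

/-- The bound in `target` keeps the exponent off `σ` in the principal strip, so the logarithm
recovers it there and `W` recovers all of it. -/
theorem coord_retract_slice (D : ChartData n a K) (s : Splitting a Ψ) (h : IsSetup n a b K Ψ)
    {v : Fin (n + ℓ) → ℂ} (hv : v ∈ D.target s b) :
    D.coord s (retract b Ψ (D.slice s v)) = v := by
  set x := Ψ (zeta b Ψ (D.slice s v)) + s.q ((coordEquiv n ℓ).symm v).1 with hx
  have hxk : x ∈ kerAC a := Submodule.add_mem _ (h.admissible.map_mem _) (s.q_mem _)
  have hlog : D.logCoord (retract b Ψ (D.slice s v)) = x := by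
    refine D.W_eq hxk fun k hk => ?_
    rw [D.retract_slice_apply, Function.extend_apply' _ _ _ hk,
      mul_div_cancel_right₀ _ (D.c_ne k)]
    have := abs_lt.1 (hv k hk)
    have hπ := Real.pi_pos
    refine Complex.log_exp ?_ ?_
    · rw [Pi.add_apply]; linarith
    · rw [Pi.add_apply]; linarith
  rw [coord, ← ContinuousLinearEquiv.eq_symm_apply, hlog]
  refine Prod.ext ?_ (funext fun j => ?_)
  · simp only [hx, map_add, s.p_map, s.p_q, zero_add]
  · simp only
    rw [D.retract_slice_apply, D.injective.extend_apply, ← mul_assoc, ← Complex.exp_add,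
      neg_add_cancel, Complex.exp_zero, one_mul]

variable [FiniteDimensional ℝ N]

theorem isOpen_target (D : ChartData n a K) (s : Splitting a Ψ) (h : IsSetup n a b K Ψ) :
    IsOpen (D.target s b) := by
  have hz : Continuous fun v => zeta b Ψ (D.slice s v) := by
    rw [continuous_iff_continuousAt]
    exact fun v => (h.contDiffAt_zeta (D.slice_mem s v)).continuousAt.comp
      (D.contDiff_slice s).continuous.continuousAt
  have hΨ : Continuous Ψ := Ψ.continuous_of_finiteDimensional
  have : D.target s b = ⋂ k : Fin m, ⋂ _ : k ∉ range D.σ, {v |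
      |(Ψ (zeta b Ψ (D.slice s v)) k + s.q ((coordEquiv n ℓ).symm v).1 k).im| <
        Real.pi / 2} := by
    ext z; simp [target]
  rw [this]
  refine isOpen_iInter_of_finite fun k => isOpen_iInter_of_finite fun _ => ?_
  refine isOpen_lt (Complex.continuous_im.comp (Continuous.add ?_ ?_)).abs continuous_const
  · exact (continuous_apply k).comp (hΨ.comp hz)
  · exact (continuous_apply k).comp (s.q.continuous.comp
      (continuous_fst.comp (coordEquiv n ℓ).symm.continuous))

/-- As `zeta` vanishes at `z`, the exponent tested by `target` is `logCoord z`, with imaginary part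
`arg (z k / c k)` off `σ`. -/
theorem coord_mem_target (D : ChartData n a K) (s : Splitting a Ψ) (h : IsSetup n a b K Ψ)
    {z : Fin m → ℂ} (hz : z ∈ D.dom) (hzq : z ∈ quadricModel a b) :
    D.coord s z ∈ D.target s b := by
  obtain ⟨η, h1, h2⟩ := D.exists_slice_coord s hz
  intro k hk
  have h3 : Ψ (zeta b Ψ (D.slice s (D.coord s z))) k +
      s.q ((coordEquiv n ℓ).symm (D.coord s z)).1 k = D.logCoord z k := by
    rw [h1, h.zeta_exp_mul (h.quadricModel_subset hzq), h.zeta_of_mem hzq, zero_sub, neg_neg,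
      coord, ContinuousLinearEquiv.symm_apply_apply]
    have := congrFun h2 k
    rw [Pi.add_apply] at this
    rw [this, add_comm]
  have h4 : D.logCoord z k = Complex.log (z k / D.c k) := D.W_apply _ k hk
  rw [h3, h4, Complex.log_im]
  exact Complex.abs_arg_lt_pi_div_two_iff.2 (Or.inl (hz k hk))

/-- Although `retract` is only smooth, it adds to the logarithms just the term `Ψ (zeta z')`. This
term is killed by `p` and cancels in the `σ`-coordinates, leaving a holomorphic expression. -/
theorem exists_eventuallyEq_germ (D : ChartData n a K) (s : Splitting a Ψ)
    (h : IsSetup n a b K Ψ) {z : Fin m → ℂ} (hz : z ∈ U K) (hzD : retract b Ψ z ∈ D.dom) :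
    ∃ C, (fun z' => D.coord s (retract b Ψ z')) =ᶠ[𝓝 z] D.germ s z C := by
  have hΨ : Continuous Ψ := Ψ.continuous_of_finiteDimensional
  have hcr := (h.contDiffAt_retract hz).continuousAt
  have hcζ := hΨ.continuousAt.comp (h.contDiffAt_zeta hz).continuousAt
  -- Fixes the branch: both sides agree at `z' = z`.
  let C : Fin m → ℂ := fun k => Complex.log (retract b Ψ z k / D.c k) - Ψ (zeta b Ψ z) k
  refine ⟨C, ?_⟩
  have hne : ∀ k ∉ range D.σ, z k ≠ 0 := fun k hk h0 => by
    have := hzD k hk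
    simp [retract, h0] at this
  have key : ∀ k, k ∉ range D.σ → ∀ᶠ z' in 𝓝 z,
      Complex.log (retract b Ψ z' k / D.c k) =
        Ψ (zeta b Ψ z') k + (Complex.log (z' k / z k) + C k) := by
    intro k hk
    have hck : ContinuousAt (fun z' => retract b Ψ z' k / D.c k) z :=
      ((continuous_apply k).continuousAt.comp hcr).div_const _
    have hcz : ContinuousAt (fun z' : Fin m → ℂ => z' k / z k) z :=
      ((continuous_apply k).div_const _).continuousAt
    refine eventuallyEq_of_exp_eq (hck.clog (Or.inl (hzD k hk)))
      (((continuous_apply k).continuousAt.comp hcζ).add ((hcz.clog ?_).add_const _)) ?_ ?_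
    · rw [div_self (hne k hk)]
      exact Complex.one_mem_slitPlane
    · simp [C, div_self (hne k hk)]
    · have hnz : ∀ᶠ z' : Fin m → ℂ in 𝓝 z, z' k ≠ 0 :=
        (continuous_apply k).continuousAt.eventually_ne (hne k hk)
      filter_upwards [hnz] with z' hz'
      have hr : ∀ y : Fin m → ℂ, y k ≠ 0 → retract b Ψ y k / D.c k ≠ 0 := fun y hy =>
        div_ne_zero (mul_ne_zero (Complex.exp_ne_zero _) hy) (D.c_ne k)
      simp only [C]
      rw [Complex.exp_add, Complex.exp_add, Complex.exp_sub, Complex.exp_log (hr z' hz'),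
        Complex.exp_log (hr z (hne k hk)), Complex.exp_log (div_ne_zero hz' (hne k hk))]
      have h1 := hne k hk
      have h2 := D.c_ne k
      have h3 := Complex.exp_ne_zero (Ψ (zeta b Ψ z) k)
      simp only [retract]
      field_simp
  have key' : ∀ᶠ z' in 𝓝 z, ∀ k, k ∉ range D.σ →
      Complex.log (retract b Ψ z' k / D.c k) =
        Ψ (zeta b Ψ z') k + (Complex.log (z' k / z k) + C k) := by
    rw [Filter.eventually_all]
    intro k
    by_cases hk : k ∈ range D.σ
    · exact Filter.Eventually.of_forall fun _ hk' => absurd hk hk'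
    · exact (key k hk).mono fun _ h _ => h
  filter_upwards [key'] with z' hz'
  have hlog : D.logCoord (retract b Ψ z') =
      Ψ (zeta b Ψ z') + D.W fun k => Complex.log (z' k / z k) + C k := by
    refine D.W_eq (Submodule.add_mem _ (h.admissible.map_mem _) (D.W_mem _)) fun k hk => ?_
    rw [hz' k hk, Pi.add_apply, D.W_apply _ k hk]
  rw [coord, germ, hlog, map_add, s.p_map, zero_add]
  congr 2
  ext j
  rw [retract, ← mul_assoc, ← Complex.exp_add, Pi.add_apply]
  congr 2
  ring

theorem contDiffAt_coord_retract (D : ChartData n a K) (s : Splitting a Ψ)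
    (h : IsSetup n a b K Ψ) {z : Fin m → ℂ} (hz : z ∈ U K) (hzD : retract b Ψ z ∈ D.dom) :
    ContDiffAt ℂ ω (fun z' => D.coord s (retract b Ψ z')) z := by
  obtain ⟨C, hC⟩ := D.exists_eventuallyEq_germ s h hz hzD
  exact (D.contDiffAt_germ s z C).congr_of_eventuallyEq hC

/-- In the charts, the group `G = exp(Ker A_ℂ)` acts locally by translations. -/
theorem eventually_coord_retract_exp_mul (D : ChartData n a K) (s : Splitting a Ψ)
    (h : IsSetup n a b K Ψ) {z : Fin m → ℂ} (hz : z ∈ U K) (hzD : retract b Ψ z ∈ D.dom) :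
    ∀ᶠ w : kerAC a in 𝓝 0,
      D.coord s (retract b Ψ fun k => Complex.exp ((w : Fin m → ℂ) k) * z k) =
        D.coord s (retract b Ψ z) + coordEquiv n ℓ (s.p (w : Fin m → ℂ), 0) := by
  obtain ⟨C, hC⟩ := D.exists_eventuallyEq_germ s h hz hzD
  have hne : ∀ k ∉ range D.σ, z k ≠ 0 := fun k hk h0 => by
    have := hzD k hk
    simp [retract, h0] at this
  have hcw : Filter.Tendsto (fun (w : kerAC a) k => Complex.exp ((w : Fin m → ℂ) k) * z k)
      (𝓝 0) (𝓝 z) := by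
    have : Continuous fun (w : kerAC a) k => Complex.exp ((w : Fin m → ℂ) k) * z k := by
      exact continuous_pi fun k =>
        (((continuous_apply k).comp continuous_subtype_val).cexp).mul continuous_const
    exact this.tendsto' _ _ (by simp)
  have him : ∀ᶠ w : kerAC a in 𝓝 0, ∀ k, |((w : Fin m → ℂ) k).im| < Real.pi := by
    rw [Filter.eventually_all]
    intro k
    have : Continuous fun w : kerAC a => |((w : Fin m → ℂ) k).im| :=
      (Complex.continuous_im.comp ((continuous_apply k).comp continuous_subtype_val)).abs
    refine (this.tendsto 0).eventually_lt_const ?_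
    simp [Real.pi_pos]
  filter_upwards [hcw.eventually hC, him] with w hw hw'
  have hC0 : D.coord s (retract b Ψ z) = D.germ s z C z := hC.self_of_nhds
  rw [hw, hC0]
  have h1 : (D.W fun k => Complex.log (Complex.exp ((w : Fin m → ℂ) k) * z k / z k) + C k) =
      (w : Fin m → ℂ) + D.W fun k => Complex.log (z k / z k) + C k := by
    refine D.W_eq (Submodule.add_mem _ w.2 (D.W_mem _)) fun k hk => ?_
    rw [Pi.add_apply, D.W_apply _ k hk, mul_div_cancel_right₀ _ (hne k hk),
      div_self (hne k hk), Complex.log_one, zero_add,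
      Complex.log_exp (abs_lt.1 (hw' k)).1 (abs_lt.1 (hw' k)).2.le]
  rw [germ, germ, h1, ← map_add, map_add s.p]
  congr 1
  refine Prod.ext (add_comm _ _) (funext fun j => ?_)
  simp only [Prod.snd_add, Pi.add_apply, Pi.zero_apply, add_zero]
  rw [← mul_assoc, ← Complex.exp_add]
  congr 2
  ring

end ChartData

end

/-! ### Smoothness and closedness of pullbacks of constant forms. -/

section Forms

theorem norm_alternatization_le {E F : Type*} [NormedAddCommGroup E] [NormedSpace ℝ E]
    [NormedAddCommGroup F] [NormedSpace ℝ F] {ι : Type*} [Fintype ι] [DecidableEq ι]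
    (f : ContinuousMultilinearMap ℝ (fun _ : ι => E) F) :
    ‖ContinuousMultilinearMap.alternatization f‖ ≤ (Fintype.card ι).factorial * ‖f‖ := by
  refine ContinuousAlternatingMap.opNorm_le_bound _ (by positivity) fun v => ?_
  rw [ContinuousMultilinearMap.alternatization_apply_apply]
  refine (norm_sum_le _ _).trans ?_
  have : ∀ σ : Equiv.Perm ι, ‖Equiv.Perm.sign σ • f (v ∘ σ)‖ ≤ ‖f‖ * ∏ i, ‖v i‖ := by
    intro σ
    rw [← Equiv.prod_comp σ fun i => ‖v i‖]
    rcases Int.units_eq_one_or (Equiv.Perm.sign σ) with h | h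
    · rw [h, one_smul]
      exact f.le_opNorm _
    · rw [h, Units.neg_smul, one_smul, norm_neg]
      exact f.le_opNorm _
  refine (Finset.sum_le_sum fun σ _ => this σ).trans ?_
  rw [Finset.sum_const, nsmul_eq_mul, Finset.card_univ, Fintype.card_perm, mul_assoc]

/-- The pullback of an alternating form by a linear map depends smoothly on the linear map. -/
theorem contDiff_compContinuousLinearMap {E F G : Type*} [NormedAddCommGroup E]
    [NormedSpace ℝ E] [NormedAddCommGroup F] [NormedSpace ℝ F] [NormedAddCommGroup G]
    [NormedSpace ℝ G] {ι : Type*} [Fintype ι] {r : WithTop ℕ∞} (α : F [⋀^ι]→L[ℝ] G) :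
    ContDiff ℝ r fun A : E →L[ℝ] F => α.compContinuousLinearMap A := by
  classical
  let alt : ContinuousMultilinearMap ℝ (fun _ : ι => E) G →L[ℝ] E [⋀^ι]→L[ℝ] G :=
    LinearMap.mkContinuous
      { toFun := fun f => ContinuousMultilinearMap.alternatization f
        map_add' := map_add _
        map_smul' := fun c f => by
          ext v
          simp only [ContinuousMultilinearMap.alternatization_apply_apply, RingHom.id_apply,
            ContinuousAlternatingMap.smul_apply, Finset.smul_sum]
          exact Finset.sum_congr rfl fun σ _ => (smul_comm _ _ _) }
      (Fintype.card ι).factorial norm_alternatization_le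
  let B := ContinuousMultilinearMap.compContinuousLinearMapContinuousMultilinear ℝ
    (fun _ : ι => E) (fun _ : ι => F) G
  have hB : ContDiff ℝ r fun A : E →L[ℝ] F => B (fun _ => A) α.toContinuousMultilinearMap :=
    (B.contDiff.comp (contDiff_pi.2 fun _ => contDiff_id)).clm_apply contDiff_const
  -- Alternatizing a form that is already alternating multiplies it by `|ι|!`, so smoothness carries
  -- over from multilinear maps.
  have : (fun A : E →L[ℝ] F => α.compContinuousLinearMap A) = fun A =>
      ((Fintype.card ι).factorial : ℝ)⁻¹ • alt (B (fun _ => A) α.toContinuousMultilinearMap) := by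
    funext A
    ext v
    have h1 : alt (B (fun _ => A) α.toContinuousMultilinearMap) v =
        ∑ σ : Equiv.Perm ι, Equiv.Perm.sign σ • α (fun i => A (v (σ i))) :=
      ContinuousMultilinearMap.alternatization_apply_apply _ _
    have h2 : ∀ σ : Equiv.Perm ι, Equiv.Perm.sign σ • α (fun i => A (v (σ i))) =
        α fun i => A (v i) := by
      intro σ
      have := α.toAlternatingMap.map_perm (fun i => A (v i)) σ
      have h3 : α (fun i => A (v (σ i))) = Equiv.Perm.sign σ • α fun i => A (v i) := this
      rw [h3, smul_smul, Int.units_mul_self, one_smul]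
    rw [ContinuousAlternatingMap.smul_apply, h1, Finset.sum_congr rfl fun σ _ => h2 σ,
      Finset.sum_const, Finset.card_univ, Fintype.card_perm, ← Nat.cast_smul_eq_nsmul ℝ,
      inv_smul_smul₀ (by positivity)]
    rfl
  rw [this]
  exact (alt.contDiff.comp hB).const_smul _

variable {d m : ℕ} {M : Type*} [TopologicalSpace M] [ChartedSpace (Fin d → ℂ) M]
  [IsManifold 𝓘(ℝ, Fin d → ℂ) ∞ M] {f : M → (Fin m → ℂ)}
  {e : OpenPartialHomeomorph M (Fin d → ℂ)}

theorem contDiffAt_comp_symm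
    (hf : ContMDiff 𝓘(ℝ, Fin d → ℂ) 𝓘(ℝ, Fin m → ℂ) ∞ f)
    (he : e ∈ atlas (Fin d → ℂ) M) {y : Fin d → ℂ} (hy : y ∈ e.target) :
    ContDiffAt ℝ ∞ (f ∘ e.symm) y :=
  ((hf (e.symm y)).comp y
    (contMDiffAt_symm_of_mem_maximalAtlas (IsManifold.subset_maximalAtlas he) hy)).contDiffAt

theorem pullbackForm_inChart
    (hf : ContMDiff 𝓘(ℝ, Fin d → ℂ) 𝓘(ℝ, Fin m → ℂ) ∞ f)
    (he : e ∈ atlas (Fin d → ℂ) M) (α : (Fin m → ℂ) [⋀^Fin 2]→L[ℝ] ℝ)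
    {y : Fin d → ℂ} (hy : y ∈ e.target) :
    (pullbackForm (d := d) f α).inChart e y = α.compContinuousLinearMap (fderiv ℝ (f ∘ e.symm) y) := by
  have h1 : MDifferentiableAt 𝓘(ℝ, Fin d → ℂ) 𝓘(ℝ, Fin d → ℂ) e.symm y :=
    (contMDiffAt_symm_of_mem_maximalAtlas (n := ∞) (IsManifold.subset_maximalAtlas he)
      hy).mdifferentiableAt (by simp)
  have h2 : MDifferentiableAt 𝓘(ℝ, Fin d → ℂ) 𝓘(ℝ, Fin m → ℂ) f (e.symm y) :=
    (hf (e.symm y)).mdifferentiableAt (by simp)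
  have h3 := mfderiv_comp y h2 h1
  rw [mfderiv_eq_fderiv] at h3
  rw [h3]
  rfl

theorem isSmooth_pullbackForm
    (hf : ContMDiff 𝓘(ℝ, Fin d → ℂ) 𝓘(ℝ, Fin m → ℂ) ∞ f)
    (α : (Fin m → ℂ) [⋀^Fin 2]→L[ℝ] ℝ) : (pullbackForm (d := d) f α).IsSmooth := by
  intro e he
  refine ContDiffOn.congr (f := fun y => α.compContinuousLinearMap (fderiv ℝ (f ∘ e.symm) y))
    (fun y hy => ?_) fun y hy => pullbackForm_inChart hf he α hy
  exact ((contDiff_compContinuousLinearMap α).contDiffAt.comp y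
    ((contDiffAt_comp_symm hf he hy).fderiv_right (by simp))).contDiffWithinAt

/-- The exterior derivative commutes with pullback, and a constant form is closed. -/
theorem isClosed_pullbackForm
    (hf : ContMDiff 𝓘(ℝ, Fin d → ℂ) 𝓘(ℝ, Fin m → ℂ) ∞ f)
    (α : (Fin m → ℂ) [⋀^Fin 2]→L[ℝ] ℝ) : (pullbackForm (d := d) f α).IsClosed := by
  intro e he y hy
  have h1 : (pullbackForm (d := d) f α).inChart e =ᶠ[𝓝 y] fun y =>
      α.compContinuousLinearMap (fderiv ℝ (f ∘ e.symm) y) := by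
    filter_upwards [e.open_target.mem_nhds hy] with y' hy'
    exact pullbackForm_inChart hf he α hy'
  rw [h1.extDeriv_eq]
  have h0 : DifferentiableAt ℝ (fun _ : Fin m → ℂ => α) ((f ∘ e.symm) y) :=
    differentiableAt_const α
  have h2 := extDeriv_pullback h0 (contDiffAt_comp_symm hf he hy)
    (by
      rw [minSmoothness_of_isRCLikeNormedField]
      exact WithTop.coe_le_coe.2 (le_top : (2 : ℕ∞) ≤ ⊤))
  rw [h2]
  have h3 : extDeriv (fun _ : Fin m → ℂ => α) ((f ∘ e.symm) y) = 0 := by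
    ext v
    rw [extDeriv_apply (differentiableAt_const α)]
    simp
  rw [h3]
  ext v
  rfl

end Forms

/-! ### The homeomorphism with the quadric model and the atlas. -/

section

variable {N : Type*} [NormedAddCommGroup N] [NormedSpace ℝ N] [FiniteDimensional ℝ N]
  {m n ℓ : ℕ} {a : Fin m → N} {b : Fin m → ℝ} {K : Set (Finset (Fin m))}
  {Ψ : (Fin ℓ → ℂ) →ₗ[ℂ] (Fin m → ℂ)}

/-- The map `Z_K → ℂ^m` sending an orbit to its representative in the quadric model. -/
def toModel (b : Fin m → ℝ) (x : ZK K Ψ) : Fin m → ℂ :=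
  retract b Ψ (Quotient.out x : U K).1

theorem continuous_proj : Continuous (proj K Ψ) := continuous_quot_mk

theorem proj_expAct (η : Fin ℓ → ℂ) (z : U K) :
    proj K Ψ (expAct (Ψ η) z) = proj K Ψ z :=
  (Quotient.sound (s := orbitSetoid K Ψ) ⟨η, rfl⟩).symm

namespace IsSetup

/-- The representative picked by `Quotient.out` is immaterial, `retract` being `C`-invariant. -/
theorem toModel_proj (h : IsSetup n a b K Ψ) (z : U K) :
    toModel b (proj K Ψ z) = retract b Ψ z.1 := by
  obtain ⟨η, hη⟩ := Quotient.exact (s := orbitSetoid K Ψ) (Quotient.out_eq (proj K Ψ z))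
  calc toModel b (proj K Ψ z)
      = retract b Ψ (expAct (Ψ η) (Quotient.out (proj K Ψ z) : U K)).1 :=
        (h.retract_exp_mul (Quotient.out (proj K Ψ z) : U K).2 η).symm
    _ = retract b Ψ z.1 := by rw [hη]

theorem toModel_mem (h : IsSetup n a b K Ψ) (x : ZK K Ψ) : toModel b x ∈ quadricModel a b :=
  h.retract_mem (Quotient.out x : U K).2

theorem toModel_mem_U (h : IsSetup n a b K Ψ) (x : ZK K Ψ) : toModel b x ∈ U K :=
  h.quadricModel_subset (h.toModel_mem x)

theorem proj_toModel (h : IsSetup n a b K Ψ) (x : ZK K Ψ) :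
    proj K Ψ ⟨toModel b x, h.toModel_mem_U x⟩ = x := by
  conv_rhs => rw [← Quotient.out_eq x]
  exact proj_expAct (zeta b Ψ (Quotient.out x : U K).1) (Quotient.out x : U K)

theorem continuous_toModel (h : IsSetup n a b K Ψ) :
    Continuous (toModel b : ZK K Ψ → Fin m → ℂ) := by
  have h1 : Continuous fun z : U K => retract b Ψ z.1 := by
    rw [continuous_iff_continuousAt]
    exact fun z => (h.contDiffAt_retract z.2).continuousAt.comp continuousAt_subtype_val
  have h2 : IsQuotientMap (proj K Ψ) := isQuotientMap_quot_mk
  rw [h2.continuous_iff]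
  convert h1 using 1
  exact funext fun z => h.toModel_proj z

/-- The homeomorphism of `Z_K` with the quadric model. -/
def modelHomeomorph (h : IsSetup n a b K Ψ) : ZK K Ψ ≃ₜ quadricModel a b where
  toFun x := ⟨toModel b x, h.toModel_mem x⟩
  invFun z := proj K Ψ ⟨z.1, h.quadricModel_subset z.2⟩
  left_inv x := h.proj_toModel x
  right_inv z := Subtype.ext ((h.toModel_proj _).trans (h.retract_of_mem z.2))
  continuous_toFun := h.continuous_toModel.subtype_mk _
  continuous_invFun := continuous_proj.comp (continuous_subtype_val.subtype_mk _)

end IsSetup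

namespace ChartData

/-- The chart of `Z_K` given by the chart data. -/
def chart (D : ChartData n a K) (s : Splitting a Ψ) (h : IsSetup n a b K Ψ) :
    OpenPartialHomeomorph (ZK K Ψ) (Fin (n + ℓ) → ℂ) where
  toFun x := D.coord s (toModel b x)
  invFun v := proj K Ψ ⟨D.slice s v, D.slice_mem s v⟩
  source := {x | toModel b x ∈ D.dom}
  target := D.target s b
  map_source' x hx := D.coord_mem_target s h hx (h.toModel_mem x)
  map_target' v hv := by
    change toModel b (proj K Ψ _) ∈ D.dom
    rw [h.toModel_proj]
    exact D.retract_slice_mem_dom s hv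
  left_inv' x hx := by
    obtain ⟨η, hη, -⟩ := D.exists_slice_coord s hx
    conv_rhs => rw [← h.proj_toModel x, ← proj_expAct (-η)]
    congr 1
    exact Subtype.ext hη
  right_inv' v hv := by
    rw [h.toModel_proj]
    exact D.coord_retract_slice s h hv
  open_source := D.isOpen_dom.preimage h.continuous_toModel
  open_target := D.isOpen_target s h
  continuousOn_toFun :=
    (D.continuousOn_coord s).comp h.continuous_toModel.continuousOn fun _ hx => hx
  continuousOn_invFun :=
    (continuous_proj.comp ((D.contDiff_slice s).continuous.subtype_mk _)).continuousOn

theorem chart_proj (D : ChartData n a K) (s : Splitting a Ψ) (h : IsSetup n a b K Ψ)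
    (z : U K) : D.chart s h (proj K Ψ z) = D.coord s (retract b Ψ z.1) :=
  congrArg (D.coord s) (h.toModel_proj z)

theorem proj_mem_source_iff (D : ChartData n a K) (s : Splitting a Ψ)
    (h : IsSetup n a b K Ψ) (z : U K) :
    proj K Ψ z ∈ (D.chart s h).source ↔ retract b Ψ z.1 ∈ D.dom := by
  rw [← h.toModel_proj]
  rfl

/-- The transition map is a holomorphic slice followed by `coord ∘ retract`, whose germs are
holomorphic. -/
theorem contDiffAt_transition (D D' : ChartData n a K) (s : Splitting a Ψ)
    (h : IsSetup n a b K Ψ) {v : Fin (n + ℓ) → ℂ}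
    (hv : v ∈ ((D.chart s h).symm.trans (D'.chart s h)).source) :
    ContDiffAt ℂ ω (D'.chart s h ∘ (D.chart s h).symm) v := by
  have h1 : D'.chart s h ∘ (D.chart s h).symm =
      (fun z => D'.coord s (retract b Ψ z)) ∘ D.slice s :=
    funext fun v => D'.chart_proj s h ⟨D.slice s v, D.slice_mem s v⟩
  rw [h1]
  refine ContDiffAt.comp v (D'.contDiffAt_coord_retract s h (D.slice_mem s v) ?_)
    (D.contDiff_slice s).contDiffAt
  rw [OpenPartialHomeomorph.trans_source] at hv
  exact (D'.proj_mem_source_iff s h ⟨D.slice s v, D.slice_mem s v⟩).1 hv.2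

end ChartData

namespace IsSetup

theorem exists_chartData (h : IsSetup n a b K Ψ) {z : Fin m → ℂ} (hz : z ∈ U K) :
    ∃ D : ChartData n a K, z ∈ D.dom := by
  classical
  obtain ⟨σ, hσ, hne, hmem⟩ := h.exists_basis hz
  obtain ⟨W, hW⟩ := exists_lift_kerAC h.finrank_eq hσ
  -- The default `1` occurs only inside `range σ`, where the value of `c` plays no role.
  refine ⟨⟨σ, hσ, hmem, fun k => if z k = 0 then 1 else z k, fun k => ?_, W,
    fun x => (hW x).1, fun x => (hW x).2⟩, fun k hk => ?_⟩
  · split_ifs with hk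
    · exact one_ne_zero
    · exact hk
  · simp only [if_neg (hne k hk), div_self (hne k hk)]
    simp

/-- The complex structure of `Z_K`. -/
@[reducible] def chartedSpace (h : IsSetup n a b K Ψ) (s : Splitting a Ψ) :
    ChartedSpace (Fin (n + ℓ) → ℂ) (ZK K Ψ) where
  atlas := range fun D : ChartData n a K => D.chart s h
  chartAt x := (h.exists_chartData (h.toModel_mem_U x)).choose.chart s h
  mem_chart_source x := (h.exists_chartData (h.toModel_mem_U x)).choose_spec
  chart_mem_atlas _ := ⟨_, rfl⟩

end IsSetup

end

/-! ### The quotient complex structure and the foliation. -/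

section

/-- The inclusion of the open set `V` has a left inverse, extended by a constant off `V` and
holomorphic near `f v`. -/
theorem contMDiffAt_codRestrict {V : TopologicalSpace.Opens (Fin m → ℂ)} {d : ℕ}
    {f : (Fin d → ℂ) → V} {v : Fin d → ℂ} (hf : ContDiffAt ℂ ω (fun v => (f v : Fin m → ℂ)) v) :
    ContMDiffAt 𝓘(ℂ, Fin d → ℂ) 𝓘(ℂ, Fin m → ℂ) ω f v := by
  classical
  let r : (Fin m → ℂ) → V := fun y => if hy : y ∈ V then ⟨y, hy⟩ else f v
  have hr : ∀ y : V, r y = y := fun y => dif_pos y.2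
  have h1 : ContMDiffAt 𝓘(ℂ, Fin m → ℂ) 𝓘(ℂ, Fin m → ℂ) ω r (f v : Fin m → ℂ) := by
    rw [← contMDiffAt_subtype_iff]
    simp only [hr]
    exact contMDiffAt_id
  have h2 := h1.comp v hf.contMDiffAt
  exact h2.congr_of_eventuallyEq (Filter.Eventually.of_forall fun v => (hr (f v)).symm)

variable {N : Type*} [NormedAddCommGroup N] [NormedSpace ℝ N] [FiniteDimensional ℝ N]
  {m n ℓ : ℕ} {a : Fin m → N} {b : Fin m → ℝ} {K : Set (Finset (Fin m))}
  {Ψ : (Fin ℓ → ℂ) →ₗ[ℂ] (Fin m → ℂ)}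

/-- All charts in the atlas of `Z_K` come from chart data. -/
def IsModelAtlas (s : Splitting a Ψ) (h : IsSetup n a b K Ψ)
    [ChartedSpace (Fin (n + ℓ) → ℂ) (ZK K Ψ)] : Prop :=
  ∀ e ∈ atlas (Fin (n + ℓ) → ℂ) (ZK K Ψ), ∃ D : ChartData n a K, e = D.chart s h

namespace IsModelAtlas

variable {s : Splitting a Ψ} {h : IsSetup n a b K Ψ}
  [ChartedSpace (Fin (n + ℓ) → ℂ) (ZK K Ψ)]

theorem isManifold_complex (hA : IsModelAtlas s h) :
    IsManifold 𝓘(ℂ, Fin (n + ℓ) → ℂ) ω (ZK K Ψ) := by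
  refine isManifold_of_contDiffOn _ _ _ fun e e' he he' => ?_
  obtain ⟨D, rfl⟩ := hA e he
  obtain ⟨D', rfl⟩ := hA e' he'
  intro v hv
  exact (D.contDiffAt_transition D' s h hv.1).contDiffWithinAt

theorem isManifold_real (hA : IsModelAtlas s h) :
    IsManifold 𝓘(ℝ, Fin (n + ℓ) → ℂ) ∞ (ZK K Ψ) := by
  refine isManifold_of_contDiffOn _ _ _ fun e e' he he' => ?_
  obtain ⟨D, rfl⟩ := hA e he
  obtain ⟨D', rfl⟩ := hA e' he'
  intro v hv
  exact (((D.contDiffAt_transition D' s h hv.1).restrict_scalars ℝ).of_le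
    le_top).contDiffWithinAt

theorem contMDiff_proj (hA : IsModelAtlas s h) :
    ContMDiff 𝓘(ℂ, Fin m → ℂ) 𝓘(ℂ, Fin (n + ℓ) → ℂ) ω (proj K Ψ) := by
  have := hA.isManifold_complex
  intro z
  have he := chart_mem_atlas (Fin (n + ℓ) → ℂ) (proj K Ψ z)
  have hx := mem_chart_source (Fin (n + ℓ) → ℂ) (proj K Ψ z)
  obtain ⟨D, hD⟩ := hA _ he
  rw [hD] at he hx
  have hdom := (D.proj_mem_source_iff s h z).1 hx
  have h1 : ContMDiffAt 𝓘(ℂ, Fin m → ℂ) 𝓘(ℂ, Fin (n + ℓ) → ℂ) ω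
      (fun z : U K => D.coord s (retract b Ψ z.1)) z :=
    contMDiffAt_subtype_iff.2 (D.contDiffAt_coord_retract s h z.2 hdom).contMDiffAt
  have h2 : ContMDiffAt 𝓘(ℂ, Fin (n + ℓ) → ℂ) 𝓘(ℂ, Fin (n + ℓ) → ℂ) ω (D.chart s h).symm
      (D.coord s (retract b Ψ z.1)) := by
    refine contMDiffAt_symm_of_mem_maximalAtlas (IsManifold.subset_maximalAtlas he) ?_
    rw [← D.chart_proj s h z]
    exact (D.chart s h).map_source hx
  refine (h2.comp z h1).congr_of_eventuallyEq ?_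
  filter_upwards [continuous_proj.continuousAt.preimage_mem_nhds
    ((D.chart s h).open_source.mem_nhds hx)] with z' hz'
  rw [Function.comp_apply, ← D.chart_proj s h z']
  exact ((D.chart s h).left_inv hz').symm

/-- A translate `S` of the slice by an element of `C` passes through `z`, and `proj ∘ S` is the
inverse chart, whose differential is onto. -/
theorem surjective_mfderiv_proj (hA : IsModelAtlas s h) (z : U K) :
    Function.Surjective
      (mfderiv 𝓘(ℂ, Fin m → ℂ) 𝓘(ℂ, Fin (n + ℓ) → ℂ) (proj K Ψ) z) := by
  have := hA.isManifold_complex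
  have : IsManifold 𝓘(ℂ, Fin (n + ℓ) → ℂ) 1 (ZK K Ψ) := IsManifold.of_le (n := ω) le_top
  have he := chart_mem_atlas (Fin (n + ℓ) → ℂ) (proj K Ψ z)
  have hx := mem_chart_source (Fin (n + ℓ) → ℂ) (proj K Ψ z)
  obtain ⟨D, hD⟩ := hA _ he
  rw [hD] at he hx
  set v := D.chart s h (proj K Ψ z)
  have hv : v ∈ (D.chart s h).target := (D.chart s h).map_source hx
  obtain ⟨η, hη⟩ := Quotient.exact (s := orbitSetoid K Ψ) ((D.chart s h).left_inv hx)
  let S : (Fin (n + ℓ) → ℂ) → U K := fun v => expAct (Ψ η) ⟨D.slice s v, D.slice_mem s v⟩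
  have hS : S v = z := hη
  have hcomp : proj K Ψ ∘ S = (D.chart s h).symm := funext fun v => proj_expAct η _
  have h1 : MDifferentiableAt 𝓘(ℂ, Fin (n + ℓ) → ℂ) 𝓘(ℂ, Fin m → ℂ) S v :=
    (contMDiffAt_codRestrict
      (D.contDiff_exp_mul_slice s η).contDiffAt).mdifferentiableAt (by simp)
  have h2 : MDifferentiableAt 𝓘(ℂ, Fin m → ℂ) 𝓘(ℂ, Fin (n + ℓ) → ℂ) (proj K Ψ) (S v) :=
    (hA.contMDiff_proj (S v)).mdifferentiableAt (by simp)
  have h3 := mfderiv_comp v h2 h1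
  have h4 : Function.Surjective (mfderiv 𝓘(ℂ, Fin (n + ℓ) → ℂ) 𝓘(ℂ, Fin (n + ℓ) → ℂ)
      (D.chart s h).symm v) :=
    (mdifferentiable_of_mem_atlas (I := 𝓘(ℂ, Fin (n + ℓ) → ℂ)) he).symm.mfderiv_surjective hv
  rw [← hS]
  rw [← hcomp, h3] at h4
  intro y
  obtain ⟨u, hu⟩ := h4 y
  exact ⟨_, hu⟩

theorem isQuotientComplexStructure (hA : IsModelAtlas s h) :
    IsQuotientComplexStructure (n + ℓ) K Ψ :=
  ⟨hA.isManifold_complex, hA.contMDiff_proj, hA.surjective_mfderiv_proj⟩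

theorem contMDiff_toModel (hA : IsModelAtlas s h) :
    ContMDiff 𝓘(ℝ, Fin (n + ℓ) → ℂ) 𝓘(ℝ, Fin m → ℂ) ∞ (toModel b : ZK K Ψ → Fin m → ℂ) := by
  have := hA.isManifold_real
  intro x
  have he := chart_mem_atlas (Fin (n + ℓ) → ℂ) x
  have hx := mem_chart_source (Fin (n + ℓ) → ℂ) x
  obtain ⟨D, hD⟩ := hA _ he
  rw [hD] at he hx
  have h1 : ContMDiffAt 𝓘(ℝ, Fin (n + ℓ) → ℂ) 𝓘(ℝ, Fin (n + ℓ) → ℂ) ∞ (D.chart s h) x :=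
    contMDiffAt_of_mem_maximalAtlas (IsManifold.subset_maximalAtlas he) hx
  have h2 : ContDiffAt ℝ ∞ (fun v => retract b Ψ (D.slice s v)) (D.chart s h x) :=
    (h.contDiffAt_retract (D.slice_mem s _)).comp _
      (((D.contDiff_slice s).contDiffAt.restrict_scalars ℝ).of_le le_top)
  refine (h2.contMDiffAt.comp x h1).congr_of_eventuallyEq ?_
  filter_upwards [(D.chart s h).open_source.mem_nhds hx] with x' hx'
  have := congrArg (toModel b) ((D.chart s h).left_inv hx')
  rw [← this]
  exact h.toModel_proj _

/-- The space of vectors tangent to the leaves, in the charts. -/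
def leafModel (n ℓ : ℕ) : Submodule ℂ (Fin (n + ℓ) → ℂ) :=
  LinearMap.range ((coordEquiv n ℓ).toLinearEquiv.toLinearMap ∘ₗ
    LinearMap.inl ℂ (Fin ℓ → ℂ) (Fin n → ℂ))

theorem finrank_leafModel (n ℓ : ℕ) : Module.finrank ℂ (leafModel n ℓ) = ℓ := by
  rw [leafModel, LinearMap.finrank_range_of_inj, Module.finrank_fin_fun]
  exact (coordEquiv n ℓ).injective.comp LinearMap.inl_injective

/-- Near the unit, the orbit map read in the chart is the translation `w ↦ chart x + (p w, 0)`, and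
`p` is onto on `Ker A_ℂ` because `p ∘ q = id`. -/
theorem map_leafTangent (hA : IsModelAtlas s h) {D : ChartData n a K} {x : ZK K Ψ}
    (he : D.chart s h ∈ atlas (Fin (n + ℓ) → ℂ) (ZK K Ψ)) (hx : x ∈ (D.chart s h).source) :
    (leafTangent (n + ℓ) a K Ψ x).map (mfderiv 𝓘(ℂ, Fin (n + ℓ) → ℂ) 𝓘(ℂ, Fin (n + ℓ) → ℂ)
      (D.chart s h) x).toLinearMap = leafModel n ℓ := by
  have := hA.isManifold_complex
  have : IsManifold 𝓘(ℂ, Fin (n + ℓ) → ℂ) 1 (ZK K Ψ) := IsManifold.of_le (n := ω) le_top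
  let o : kerAC a → ZK K Ψ := fun w => expActQuotient (w : Fin m → ℂ) x
  let z : U K := ⟨toModel b x, h.toModel_mem_U x⟩
  have hz : proj K Ψ z = x := h.proj_toModel x
  have ho : ∀ w, o w = proj K Ψ (expAct (w : Fin m → ℂ) z) := fun w => by
    change expActQuotient (w : Fin m → ℂ) x = _
    rw [← hz]
    rfl
  have ho0 : o 0 = x := by
    rw [ho, ← hz]
    congr 1
    ext k
    simp [expAct]
  let T : kerAC a →L[ℂ] (Fin (n + ℓ) → ℂ) :=
    (coordEquiv n ℓ : ((Fin ℓ → ℂ) × (Fin n → ℂ)) →L[ℂ] (Fin (n + ℓ) → ℂ)) ∘L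
      ContinuousLinearMap.inl ℂ (Fin ℓ → ℂ) (Fin n → ℂ) ∘L
      s.p ∘L (kerAC a).subtypeL
  have hco : Continuous o := by
    have : Continuous fun w : kerAC a => proj K Ψ (expAct (w : Fin m → ℂ) z) := by
      refine continuous_proj.comp (Continuous.subtype_mk (continuous_pi fun k => ?_) _)
      exact (((continuous_apply k).comp continuous_subtype_val).cexp).mul continuous_const
    exact (funext ho : o = _) ▸ this
  have hretr : retract b Ψ z.1 = toModel b x := h.retract_of_mem (h.toModel_mem x)
  have heo : ∀ᶠ w in 𝓝 0, D.chart s h (o w) = D.chart s h x + T w := by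
    have hxd : retract b Ψ z.1 ∈ D.dom := by rw [hretr]; exact hx
    filter_upwards [D.eventually_coord_retract_exp_mul s h z.2 hxd] with w hw
    rw [ho, D.chart_proj]
    refine hw.trans ?_
    rw [hretr]
    rfl
  have hder : HasFDerivAt (D.chart s h ∘ o) T 0 := by
    have h1 : HasFDerivAt (fun w => D.chart s h x + T w) T 0 := T.hasFDerivAt.const_add _
    exact h1.congr_of_eventuallyEq heo
  have hmo : MDifferentiableAt 𝓘(ℂ, kerAC a) 𝓘(ℂ, Fin (n + ℓ) → ℂ) o 0 := by
    have h1 : MDifferentiableAt 𝓘(ℂ, kerAC a) 𝓘(ℂ, Fin (n + ℓ) → ℂ) (D.chart s h ∘ o) 0 :=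
      hder.differentiableAt.mdifferentiableAt
    have h2 : MDifferentiableAt 𝓘(ℂ, Fin (n + ℓ) → ℂ) 𝓘(ℂ, Fin (n + ℓ) → ℂ) (D.chart s h).symm
        ((D.chart s h ∘ o) 0) := by
      refine mdifferentiableAt_atlas_symm he ((D.chart s h).map_source ?_)
      rwa [ho0]
    refine (h2.comp 0 h1).congr_of_eventuallyEq ?_
    filter_upwards [hco.continuousAt.preimage_mem_nhds
      ((D.chart s h).open_source.mem_nhds (ho0.symm ▸ hx : o 0 ∈ _))] with w hw
    exact ((D.chart s h).left_inv hw).symm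
  have hme : MDifferentiableAt 𝓘(ℂ, Fin (n + ℓ) → ℂ) 𝓘(ℂ, Fin (n + ℓ) → ℂ) (D.chart s h)
      (o 0) := mdifferentiableAt_atlas he (ho0.symm ▸ hx)
  have hcomp := mfderiv_comp 0 hme hmo
  rw [mfderiv_eq_fderiv, hder.fderiv] at hcomp
  let A : ZK K Ψ → ((Fin (n + ℓ) → ℂ) →L[ℂ] (Fin (n + ℓ) → ℂ)) := fun y =>
    mfderiv 𝓘(ℂ, Fin (n + ℓ) → ℂ) 𝓘(ℂ, Fin (n + ℓ) → ℂ) (D.chart s h) y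
  let B : kerAC a →L[ℂ] (Fin (n + ℓ) → ℂ) :=
    mfderiv 𝓘(ℂ, kerAC a) 𝓘(ℂ, Fin (n + ℓ) → ℂ) o 0
  have hAB : T = (A x).comp B := by
    rw [← ho0]
    exact hcomp
  change (LinearMap.range B.toLinearMap).map (A x).toLinearMap = leafModel n ℓ
  rw [← LinearMap.range_comp]
  have hrT : LinearMap.range T.toLinearMap = leafModel n ℓ := by
    ext v
    constructor
    · rintro ⟨w, rfl⟩
      exact ⟨s.p (w : Fin m → ℂ), rfl⟩
    · rintro ⟨t, rfl⟩
      refine ⟨⟨s.q t, s.q_mem t⟩, ?_⟩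
      change coordEquiv n ℓ (s.p (s.q t), 0) = coordEquiv n ℓ (t, 0)
      rw [s.p_q]
  rw [← hrT, hAB]
  rfl

theorem isHolomorphicFoliation (hA : IsModelAtlas s h) :
    IsHolomorphicFoliation ℓ (leafTangent (n + ℓ) a K Ψ) := by
  have := hA.isManifold_complex
  intro x
  have he := chart_mem_atlas (Fin (n + ℓ) → ℂ) x
  refine ⟨_, IsManifold.subset_maximalAtlas he, mem_chart_source _ x, leafModel n ℓ,
    finrank_leafModel n ℓ, ?_⟩
  obtain ⟨D, hD⟩ := hA _ he
  rw [hD] at he ⊢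
  exact fun y hy => hA.map_leafTangent he hy

end IsModelAtlas

end

/-! ### The differential of the embedding and the transverse Kähler property. -/

section

variable {N : Type*} [NormedAddCommGroup N] [NormedSpace ℝ N]
  {m n ℓ : ℕ} {a : Fin m → N} {b : Fin m → ℝ} {K : Set (Finset (Fin m))}
  {Ψ : (Fin ℓ → ℂ) →ₗ[ℂ] (Fin m → ℂ)}

theorem ChartData.fderiv_exp_mul_slice (D : ChartData n a K) (s : Splitting a Ψ)
    (η : Fin ℓ → ℂ) (v u : Fin (n + ℓ) → ℂ) (k : Fin m) :
    fderiv ℂ (fun v k => Complex.exp (Ψ η k) * D.slice s v k) v u k =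
      Complex.exp (Ψ η k) * D.slice s v k * s.q ((coordEquiv n ℓ).symm u).1 k +
      Complex.exp (Ψ η k) * Complex.exp (s.q ((coordEquiv n ℓ).symm v).1 k) *
        Function.extend D.σ ((coordEquiv n ℓ).symm u).2 0 k := by
  have hd : HasFDerivAt (fun v k => Complex.exp (Ψ η k) * D.slice s v k)
      (fderiv ℂ (fun v k => Complex.exp (Ψ η k) * D.slice s v k) v) (v + (0 : ℂ) • u) := by
    rw [zero_smul, add_zero]
    exact ((D.contDiff_exp_mul_slice s η).differentiable (by simp) v).hasFDerivAt
  have hline : HasDerivAt (fun t : ℂ => v + t • u) u 0 := by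
    simpa using ((hasDerivAt_id (0 : ℂ)).smul_const u).const_add v
  have h1 := hasDerivAt_pi.1 (hd.comp_hasDerivAt 0 hline) k
  have hq : HasDerivAt (fun t : ℂ => s.q ((coordEquiv n ℓ).symm (v + t • u)).1 k)
      (s.q ((coordEquiv n ℓ).symm u).1 k) 0 := by
    have : (fun t : ℂ => s.q ((coordEquiv n ℓ).symm (v + t • u)).1 k) = fun t =>
        s.q ((coordEquiv n ℓ).symm v).1 k + t * s.q ((coordEquiv n ℓ).symm u).1 k := by
      funext t
      simp
    rw [this]
    simpa using ((hasDerivAt_id (0 : ℂ)).mul_const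
      (s.q ((coordEquiv n ℓ).symm u).1 k)).const_add (s.q ((coordEquiv n ℓ).symm v).1 k)
  have hext : HasDerivAt
      (fun t : ℂ => Function.extend D.σ ((coordEquiv n ℓ).symm (v + t • u)).2 D.c k)
      (Function.extend D.σ ((coordEquiv n ℓ).symm u).2 0 k) 0 := by
    by_cases hk : k ∈ range D.σ
    · obtain ⟨j, rfl⟩ := hk
      simp only [D.injective.extend_apply]
      have : (fun t : ℂ => ((coordEquiv n ℓ).symm (v + t • u)).2 j) = fun t =>
          ((coordEquiv n ℓ).symm v).2 j + t * ((coordEquiv n ℓ).symm u).2 j := by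
        funext t
        simp
      rw [this]
      simpa using ((hasDerivAt_id (0 : ℂ)).mul_const
        (((coordEquiv n ℓ).symm u).2 j)).const_add (((coordEquiv n ℓ).symm v).2 j)
    · simp only [Function.extend_apply' _ _ _ hk]
      exact hasDerivAt_const _ _
  have h2 := (hq.cexp.mul hext).const_mul (Complex.exp (Ψ η k))
  rw [h1.unique h2]
  simp only [slice, zero_smul, add_zero]
  ring

/-- The vectors tangent to the leaves are those which the slice maps to `z · Ker A_ℂ`. -/
theorem ChartData.exists_fderiv_slice_eq_iff (D : ChartData n a K) (s : Splitting a Ψ)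
    (η : Fin ℓ → ℂ) (v u : Fin (n + ℓ) → ℂ) {z : Fin m → ℂ}
    (hz : (fun k => Complex.exp (Ψ η k) * D.slice s v k) = z) :
    (∃ κ ∈ kerAC a, fderiv ℂ (fun v k => Complex.exp (Ψ η k) * D.slice s v k) v u = z * κ) ↔
      u ∈ IsModelAtlas.leafModel n ℓ := by
  subst hz
  constructor
  · rintro ⟨κ, hκ, hu⟩
    have hk := fun k => (D.fderiv_exp_mul_slice s η v u k).symm.trans (congrFun hu k)
    -- Off `σ` the slice has nonzero coordinates and no linear term, so the two kernel elements
    -- agree there, hence everywhere.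
    have h1 : s.q ((coordEquiv n ℓ).symm u).1 = κ := by
      rw [← sub_eq_zero]
      refine eq_zero_of_mem_kerAC D.li (Submodule.sub_mem _ (s.q_mem _) hκ) fun k hkσ => ?_
      have h2 := hk k
      have h3 : Complex.exp (Ψ η k) * D.slice s v k ≠ 0 := by
        rw [slice, Function.extend_apply' _ _ _ hkσ]
        exact mul_ne_zero (Complex.exp_ne_zero _) (mul_ne_zero (Complex.exp_ne_zero _) (D.c_ne k))
      rw [Function.extend_apply' _ _ _ hkσ, Pi.zero_apply, mul_zero, add_zero] at h2
      exact sub_eq_zero.2 (mul_left_cancel₀ h3 h2)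
    have h4 : ((coordEquiv n ℓ).symm u).2 = 0 := by
      ext j
      have h2 := hk (D.σ j)
      rw [h1, D.injective.extend_apply, Pi.mul_apply, add_eq_left] at h2
      exact (mul_eq_zero.1 h2).resolve_left
        (mul_ne_zero (Complex.exp_ne_zero _) (Complex.exp_ne_zero _))
    refine ⟨((coordEquiv n ℓ).symm u).1, ?_⟩
    change coordEquiv n ℓ (((coordEquiv n ℓ).symm u).1, 0) = u
    rw [← h4]
    exact (coordEquiv n ℓ).apply_symm_apply u
  · rintro ⟨t, rfl⟩
    refine ⟨s.q t, s.q_mem t, ?_⟩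
    ext k
    rw [D.fderiv_exp_mul_slice s η v _ k]
    have : (coordEquiv n ℓ).symm (((coordEquiv n ℓ).toLinearEquiv.toLinearMap ∘ₗ
        LinearMap.inl ℂ (Fin ℓ → ℂ) (Fin n → ℂ)) t) = (t, 0) :=
      (coordEquiv n ℓ).symm_apply_apply (t, 0)
    rw [this]
    have h0 : Function.extend D.σ (0 : Fin n → ℂ) 0 k = 0 := by
      by_cases hk : k ∈ range D.σ
      · obtain ⟨j, rfl⟩ := hk
        rw [D.injective.extend_apply, Pi.zero_apply]
      · rw [Function.extend_apply' _ _ _ hk, Pi.zero_apply]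
    rw [h0, mul_zero, add_zero, Pi.mul_apply]

variable [FiniteDimensional ℝ N]

/-- Differentiate `exp(Ψ (zeta y)) y` at a point where `zeta` vanishes: `κ` is `Ψ` of the derivative
of `zeta`. -/
theorem IsSetup.fderiv_retract_eq (h : IsSetup n a b K Ψ) {z : Fin m → ℂ}
    (hz : z ∈ quadricModel a b) (u : Fin m → ℂ) :
    ∃ κ ∈ kerAC a, fderiv ℝ (retract b Ψ) z u = u + z * κ := by
  have hzU := h.quadricModel_subset hz
  let ΨR : (Fin ℓ → ℂ) →L[ℝ] (Fin m → ℂ) :=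
    LinearMap.toContinuousLinearMap (Ψ.restrictScalars ℝ)
  have hζ : HasFDerivAt (zeta b Ψ) (fderiv ℝ (zeta b Ψ) z) z :=
    ((h.contDiffAt_zeta hzU).differentiableAt (by simp)).hasFDerivAt
  have hr : HasFDerivAt (retract b Ψ) (fderiv ℝ (retract b Ψ) z) z :=
    ((h.contDiffAt_retract hzU).differentiableAt (by simp)).hasFDerivAt
  refine ⟨Ψ (fderiv ℝ (zeta b Ψ) z u), h.admissible.map_mem _, ?_⟩
  ext k
  have h1 : HasFDerivAt (fun y => Ψ (zeta b Ψ y) k)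
      ((ContinuousLinearMap.proj (R := ℝ) (φ := fun _ : Fin m => ℂ) k).comp
        (ΨR.comp (fderiv ℝ (zeta b Ψ) z))) z :=
    (ContinuousLinearMap.proj (R := ℝ) (φ := fun _ : Fin m => ℂ) k).hasFDerivAt.comp z
      (ΨR.hasFDerivAt.comp z hζ)
  have h2 : HasFDerivAt (fun y : Fin m → ℂ => y k)
      (ContinuousLinearMap.proj (R := ℝ) (φ := fun _ : Fin m => ℂ) k) z :=
    (ContinuousLinearMap.proj (R := ℝ) (φ := fun _ : Fin m => ℂ) k).hasFDerivAt
  have h3 := (hasFDerivAt_pi'.1 hr k).unique (h1.cexp.mul h2)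
  have h4 := congrArg (fun g : (Fin m → ℂ) →L[ℝ] ℂ => g u) h3
  simp only [h.zeta_of_mem hz, map_zero, Pi.zero_apply, Complex.exp_zero, one_smul] at h4
  refine h4.trans ?_
  change u k + z k * Ψ (fderiv ℝ (zeta b Ψ) z u) k = _
  rfl

/-- On the quadric model `∑ r_k |z_k|² = ∑ r_k b_k` for each relation `r`; differentiate this along
`retract`. -/
theorem IsSetup.sum_fderiv_retract_eq_zero (h : IsSetup n a b K Ψ) {z : Fin m → ℂ}
    (hz : z ∈ quadricModel a b) (u : Fin m → ℂ) (r : Fin m → ℝ) (hr : ∑ i, r i • a i = 0) :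
    ∑ k, r k * (star (z k) * fderiv ℝ (retract b Ψ) z u k).re = 0 := by
  have hzU := h.quadricModel_subset hz
  have hd : HasFDerivAt (retract b Ψ) (fderiv ℝ (retract b Ψ) z) z :=
    ((h.contDiffAt_retract hzU).differentiableAt (by simp)).hasFDerivAt
  have h1 : HasFDerivAt (fun y => ∑ k, r k * ‖retract b Ψ y k‖ ^ 2)
      (∑ k, r k • (2 • (innerSL ℝ (retract b Ψ z k)).comp
        ((ContinuousLinearMap.proj (R := ℝ) (φ := fun _ : Fin m => ℂ) k).comp
          (fderiv ℝ (retract b Ψ) z)))) z :=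
    HasFDerivAt.fun_sum fun k _ => ((hasFDerivAt_pi'.1 hd k).norm_sq).const_mul (r k)
  have h2 : (fun y => ∑ k, r k * ‖retract b Ψ y k‖ ^ 2) =ᶠ[𝓝 z] fun _ => ∑ k, r k * b k := by
    filter_upwards [(U K).isOpen.mem_nhds hzU] with y hy
    obtain ⟨w, -, hw⟩ := h.retract_mem hy
    have h3 : ∑ k, r k * w (a k) = 0 := by
      have := congrArg w hr
      rw [map_sum, map_zero] at this
      rw [← this]
      exact Finset.sum_congr rfl fun k _ => by rw [map_smul, smul_eq_mul]
    simp only [hw, mul_add, Finset.sum_add_distrib, h3, zero_add]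
  have h3 := h1.unique ((hasFDerivAt_const _ z).congr_of_eventuallyEq h2)
  have h4 := congrArg (fun g : (Fin m → ℂ) →L[ℝ] ℝ => g u) h3
  simp only [sum_apply, smul_apply, ContinuousLinearMap.comp_apply, innerSL_apply_apply,
    zero_apply, ContinuousLinearMap.proj_apply, Complex.inner, h.retract_of_mem hz,
    smul_eq_mul, nsmul_eq_mul] at h4
  have h5 : (2 : ℝ) * ∑ k, r k * (star (z k) * fderiv ℝ (retract b Ψ) z u k).re = 0 := by
    rw [Finset.mul_sum, ← h4]
    refine Finset.sum_congr rfl fun k _ => ?_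
    simp only [RCLike.star_def, Nat.cast_ofNat]
    rw [mul_comm ((starRingEnd ℂ) (z k))]
    ring
  exact (mul_eq_zero.1 h5).resolve_left two_ne_zero

namespace IsModelAtlas

variable {s : Splitting a Ψ} {h : IsSetup n a b K Ψ}
  [ChartedSpace (Fin (n + ℓ) → ℂ) (ZK K Ψ)]

/-- The differential of `φ : Z_K → ℂ^m`. -/
def dModel (b : Fin m → ℝ) (x : ZK K Ψ) : (Fin (n + ℓ) → ℂ) →L[ℝ] (Fin m → ℂ) :=
  mfderiv 𝓘(ℝ, Fin (n + ℓ) → ℂ) 𝓘(ℝ, Fin m → ℂ) (toModel b : ZK K Ψ → Fin m → ℂ) x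

/-- In a chart, `φ` is the composition of a holomorphic slice with the projection to the quadric
model. -/
theorem exists_mfderiv_toModel (hA : IsModelAtlas s h) (x : ZK K Ψ) :
    ∃ T : (Fin (n + ℓ) → ℂ) →L[ℂ] (Fin m → ℂ),
      (∀ v, dModel b x v = fderiv ℝ (retract b Ψ) (toModel b x) (T v)) ∧
      (∀ v : Fin (n + ℓ) → ℂ, (∃ κ ∈ kerAC a, T v = toModel b x * κ) ↔
        v ∈ leafTangent (n + ℓ) a K Ψ x) ∧
      ∃ F : (Fin m → ℂ) →L[ℝ] (Fin (n + ℓ) → ℂ), ∀ v,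
        F (fderiv ℝ (retract b Ψ) (toModel b x) (T v)) = v := by
  have := hA.isManifold_real
  have := hA.isManifold_complex
  have : IsManifold 𝓘(ℂ, Fin (n + ℓ) → ℂ) 1 (ZK K Ψ) := IsManifold.of_le (n := ω) le_top
  have he := chart_mem_atlas (Fin (n + ℓ) → ℂ) x
  have hx := mem_chart_source (Fin (n + ℓ) → ℂ) x
  -- Tangent vectors at `x` are read in the preferred chart, whose differential at `x` is therefore
  -- the identity.
  have hmap : ∀ e : OpenPartialHomeomorph (ZK K Ψ) (Fin (n + ℓ) → ℂ),
      chartAt (Fin (n + ℓ) → ℂ) x = e →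
      (leafTangent (n + ℓ) a K Ψ x).map (mfderiv 𝓘(ℂ, Fin (n + ℓ) → ℂ) 𝓘(ℂ, Fin (n + ℓ) → ℂ)
        e x).toLinearMap = leafTangent (n + ℓ) a K Ψ x := by
    rintro _ rfl
    have hid := mfderiv_extChartAt_self (I := 𝓘(ℂ, Fin (n + ℓ) → ℂ)) (x := x)
    simp only [extChartAt, mfld_simps] at hid
    rw [hid]
    exact Submodule.map_id _
  have hmf := ((hA.contMDiff_toModel x).mdifferentiableAt (by simp)).mfderiv
  obtain ⟨D, hD⟩ := hA _ he
  simp only [writtenInExtChartAt, extChartAt, hD, mfld_simps, fderivWithin_univ] at hmf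
  rw [hD] at he hx
  obtain ⟨η, hη, -⟩ := D.exists_slice_coord s hx
  set z := toModel b x with hzdef
  have hzq : z ∈ quadricModel a b := h.toModel_mem x
  set S : (Fin (n + ℓ) → ℂ) → (Fin m → ℂ) :=
    fun v k => Complex.exp (Ψ η k) * D.slice s v k with hSdef
  set v₀ := D.chart s h x with hv₀
  have hS0 : S v₀ = z := by
    ext k
    have := congrFun hη k
    change D.slice s v₀ k = _ at this
    simp only [hSdef]
    rw [this, ← mul_assoc, ← Complex.exp_add, map_neg, Pi.neg_apply, add_neg_cancel,
      Complex.exp_zero, one_mul]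
  have hcomp : (toModel b ∘ (D.chart s h).symm : (Fin (n + ℓ) → ℂ) → Fin m → ℂ) =
      retract b Ψ ∘ S := by
    funext v
    exact (h.toModel_proj _).trans (h.retract_exp_mul (D.slice_mem s v) η).symm
  have hdS : DifferentiableAt ℂ S v₀ :=
    (D.contDiff_exp_mul_slice s η).differentiable (by simp) v₀
  have hdr : DifferentiableAt ℝ (retract b Ψ) z :=
    (h.contDiffAt_retract (h.quadricModel_subset hzq)).differentiableAt (by simp)
  have hder : HasFDerivAt (retract b Ψ ∘ S)
      ((fderiv ℝ (retract b Ψ) z).comp ((fderiv ℂ S v₀).restrictScalars ℝ)) v₀ := by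
    refine HasFDerivAt.comp v₀ ?_ (hdS.hasFDerivAt.restrictScalars ℝ)
    rw [hS0]
    exact hdr.hasFDerivAt
  refine ⟨fderiv ℂ S v₀, fun v => ?_, fun v => ?_, ?_⟩
  · have h1 : fderiv ℝ (toModel b ∘ (D.chart s h).symm) v₀ =
        (fderiv ℝ (retract b Ψ) z).comp ((fderiv ℂ S v₀).restrictScalars ℝ) := by
      rw [hcomp, hder.fderiv]
    exact congrArg (fun g : (Fin (n + ℓ) → ℂ) →L[ℝ] (Fin m → ℂ) => g v) (hmf.trans h1)
  · rw [D.exists_fderiv_slice_eq_iff s η v₀ v hS0]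
    have h2 : leafTangent (n + ℓ) a K Ψ x = leafModel n ℓ :=
      (hmap _ hD).symm.trans (hA.map_leafTangent he hx)
    rw [h2]
    rfl
  -- The left inverse `F` is the differential at `z` of `coord ∘ retract`, which undoes the
  -- parametrization `retract ∘ S`.
  · have hdom : retract b Ψ z ∈ D.dom := by
      rw [h.retract_of_mem hzq]
      exact hx
    have hF := ((D.contDiffAt_coord_retract s h (h.quadricModel_subset hzq)
      hdom).differentiableAt (by simp)).hasFDerivAt.restrictScalars ℝ
    refine ⟨(fderiv ℂ (fun z' => D.coord s (retract b Ψ z')) z).restrictScalars ℝ,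
      fun v => ?_⟩
    have hr0 : (retract b Ψ ∘ S) v₀ = z := by
      rw [Function.comp_apply, hS0, h.retract_of_mem hzq]
    rw [← hr0] at hF
    have h1 := hF.comp v₀ hder
    have h2 : ((fun z' => D.coord s (retract b Ψ z')) ∘ (retract b Ψ ∘ S)) =ᶠ[𝓝 v₀] id := by
      filter_upwards [(D.chart s h).open_target.mem_nhds ((D.chart s h).map_source hx)]
        with v hv
      have h3 : (retract b Ψ ∘ S) v = retract b Ψ (D.slice s v) :=
        h.retract_exp_mul (D.slice_mem s v) η
      rw [Function.comp_apply, h3, h.retract_of_mem (h.retract_mem (D.slice_mem s v))]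
      exact D.coord_retract_slice s h hv
    have h3 := h1.unique ((hasFDerivAt_id v₀).congr_of_eventuallyEq h2)
    rw [hr0] at h3
    exact congrArg (fun g : (Fin (n + ℓ) → ℂ) →L[ℝ] (Fin (n + ℓ) → ℂ) => g v) h3

theorem injective_mfderiv_toModel (hA : IsModelAtlas s h) (x : ZK K Ψ) :
    Function.Injective (mfderiv 𝓘(ℝ, Fin (n + ℓ) → ℂ) 𝓘(ℝ, Fin m → ℂ)
      (toModel b : ZK K Ψ → Fin m → ℂ) x) := by
  obtain ⟨T, hT, -, F, hF⟩ := hA.exists_mfderiv_toModel x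
  change Function.Injective (dModel b x)
  intro v w hvw
  rw [hT, hT] at hvw
  rw [← hF v, hvw, hF w]

theorem pullbackForm_toModel_apply (x : ZK K Ψ) (v w : Fin (n + ℓ) → ℂ) :
    pullbackForm (toModel b : ZK K Ψ → Fin m → ℂ) (standardForm m) x ![v, w] =
      standardForm m ![dModel b x v, dModel b x w] := by
  change standardForm m (dModel b x ∘ ![v, w]) = _
  congr 1
  ext i : 1
  fin_cases i <;> rfl

/-- With `dφ = L ∘ T` and `T` complex linear, `J` becomes multiplication by `i` before `L`, and the
Hermitian lemmas apply. -/
theorem isTransverseKahler (hA : IsModelAtlas s h) :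
    IsTransverseKahler (leafTangent (n + ℓ) a K Ψ)
      (pullbackForm (toModel b : ZK K Ψ → Fin m → ℂ) (standardForm m)) := by
  have := hA.isManifold_real
  refine ⟨isSmooth_pullbackForm hA.contMDiff_toModel _, fun x => ?_,
    isClosed_pullbackForm hA.contMDiff_toModel _, fun x => ?_, fun x => ?_⟩
  all_goals
    obtain ⟨T, hT, hT', -⟩ := hA.exists_mfderiv_toModel x
    have hL := h.fderiv_retract_eq (h.toModel_mem x)
    have hL' := h.sum_fderiv_retract_eq_zero (h.toModel_mem x)
  · intro (v : Fin (n + ℓ) → ℂ) (w : Fin (n + ℓ) → ℂ)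
    have h1 := standardForm_apply_I_smul hL hL' (T v) (T w)
    rw [← map_smul, ← map_smul, ← hT, ← hT, ← hT, ← hT, ← pullbackForm_toModel_apply,
      ← pullbackForm_toModel_apply] at h1
    exact h1
  · intro (v : Fin (n + ℓ) → ℂ)
    have h1 := (standardForm_apply_self hL hL' (T v)).1
    rw [← map_smul, ← hT, ← hT, ← pullbackForm_toModel_apply] at h1
    exact h1
  · intro (v : Fin (n + ℓ) → ℂ)
    have h1 := (standardForm_apply_self hL hL' (T v)).2
    rw [← map_smul, ← hT, ← hT, ← pullbackForm_toModel_apply] at h1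
    exact h1.trans (hT' v)

end IsModelAtlas

end

end MomentAngle

end

theorem proposition4p4 {N : Type*} [NormedAddCommGroup N] [NormedSpace ℝ N]
    [FiniteDimensional ℝ N] {n m ℓ : ℕ} (hn : Module.finrank ℝ N = n) (hm : m = n + 2 * ℓ)
    (a : Fin m → N) (b : Fin m → ℝ) (hP : MomentAngle.IsSimplePolytope a b)
    (K : Set (Finset (Fin m))) (hK : K = MomentAngle.nerveComplex a b)
    (Ψ : (Fin ℓ → ℂ) →ₗ[ℂ] (Fin m → ℂ)) (hΨ : MomentAngle.IsAdmissible a Ψ) :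
    ∃ _ : ChartedSpace (Fin (n + ℓ) → ℂ) (MomentAngle.ZK K Ψ),
      MomentAngle.IsQuotientComplexStructure (n + ℓ) K Ψ ∧
      MomentAngle.IsHolomorphicFoliation ℓ (MomentAngle.leafTangent (n + ℓ) a K Ψ) ∧
      ∃ (hU : MomentAngle.quadricModel a b ⊆ MomentAngle.U K)
        (φ : MomentAngle.ZK K Ψ ≃ₜ MomentAngle.quadricModel a b),
        -- `φ` is the inverse of the composition `Z_P → U(K) → U(K)/C`
        (∀ z : MomentAngle.quadricModel a b,
          φ (MomentAngle.proj K Ψ ⟨z.1, hU z.2⟩) = z) ∧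
        -- `φ` is a diffeomorphism onto the submanifold `Z_P` of `ℂ^m`
        ContMDiff 𝓘(ℝ, Fin (n + ℓ) → ℂ) 𝓘(ℝ, Fin m → ℂ) ∞
          (fun x => (φ x : Fin m → ℂ)) ∧
        (∀ x, Function.Injective (mfderiv 𝓘(ℝ, Fin (n + ℓ) → ℂ) 𝓘(ℝ, Fin m → ℂ)
          (fun x => (φ x : Fin m → ℂ)) x)) ∧
        MomentAngle.IsTransverseKahler (MomentAngle.leafTangent (n + ℓ) a K Ψ)
          (MomentAngle.pullbackForm (fun x => (φ x : Fin m → ℂ))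
            (MomentAngle.standardForm m)) := by
  have h : MomentAngle.IsSetup n a b K Ψ := ⟨hn, hm, hP, hK, hΨ⟩
  obtain ⟨s⟩ := h.nonempty_splitting
  let _ := h.chartedSpace s
  have hA : MomentAngle.IsModelAtlas s h := by
    rintro _ ⟨D, rfl⟩
    exact ⟨D, rfl⟩
  exact ⟨h.chartedSpace s, hA.isQuotientComplexStructure, hA.isHolomorphicFoliation,
    h.quadricModel_subset, h.modelHomeomorph, fun z => h.modelHomeomorph.apply_symm_apply z,
    hA.contMDiff_toModel, hA.injective_mfderiv_toModel, hA.isTransverseKahler⟩
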